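/- Let $\Bbbk$ be a field, $S=\Bbbk[x_1,\dots,x_n]$, and let $I\subsetneq S$ be a proper Borel fixed (strongly stable) ideal: a monomial ideal such that, writing $G(I)$ for its set of minimal monomial generators, $\mathsf m\in G(I)$, $x_i\mid \mathsf m$ and $j<i$ imply $(x_j/x_i)\,\mathsf m\in I$. Let $d$ be an integer with $\deg \mathsf m\le d$ for all $\mathsf m\in G(I)$, and let $\widetilde S=\Bbbk[x_{i,j}\mid 1\le i\le n,\ 1\le j\le d]$ with its $\mathbb Z^{n\times d}$-grading. For a monomial $\mathsf m=\prod_i x_i^{a_i}$ with $\deg \mathsf m\le d$, put $b_i=a_1+\dots+a_i$, $\nu(\mathsf m)=\max\{i\mid a_i>0\}$, and $\widetilde{\mathsf m}=\text{b-pol}(\mathsf m)=\prod_{i}\prod_{b_{i-1}<j\le b_i}x_{i,j}\in\widetilde S$. Let $\text{b-pol}(I)=(\widetilde{\mathsf m}\mid \mathsf m\in G(I))\subset\widetilde S$. Every monomial $\mathsf m\in I$ has a unique factorization $\mathsf m=\mathsf m_1\mathsf m_2$ with $\mathsf m_1\in G(I)$ and every variable of $\mathsf m_1$ having index at most that of every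 variable of $\mathsf m_2$; put $g(\mathsf m)=\mathsf m_1$. For $\mathsf m\in G(I)$ and $i<\nu(\mathsf m)$ put $\mathsf m_{\langle i\rangle}=g\big((x_i/x_k)\cdot \mathsf m\big)$, where $k=\min\{l>i\mid x_l \text{ divides } \mathsf m\}$; for $i\ge\nu(\mathsf m)$ put $\mathsf m_{\langle i\rangle}=\mathsf m$. Write $\widetilde{\mathsf m}_{\langle i\rangle}=\text{b-pol}(\mathsf m_{\langle i\rangle})$. A pair $(\widetilde F,\widetilde{\mathsf m})$ with $\mathsf m\in G(I)$ and $\widetilde F=\{(i_1,j_1),\dots,(i_q,j_q)\}$ (possibly empty) is called admissible if $1\le i_1<\dots<i_q<\nu(\mathsf m)$ and $j_r=1+\sum_{l\le i_r}a_l$ for all $r$. For an admissible pair put $\widetilde F_r=\widetilde F\setminus\{(i_r,j_r)\}$ and let $B(\widetilde F,\widetilde{\mathsf m})$ be the set of $r$ such that $(\widetilde F_r,\widetilde{\mathsf m}_{\langle i_r\rangle})$ is admissible. Let $\widetilde P_0=\widetilde S$, and for $q\ge 0$ let $\widetilde P_{q+1}$ be the free $\widetilde S$-module with basis the symbols $e(\widetilde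 F,\widetilde{\mathsf m})$, $(\widetilde F,\widetilde{\mathsf m})$ admissible with $\#\widetilde F=q$, where $e(\widetilde F,\widetilde{\mathsf m})$ has the degree of the monomial $\widetilde{\mathsf m}\prod_{(i,j)\in\widetilde F}x_{i,j}$ in $\mathbb Z^{n\times d}$. Define $\widetilde S$-linear maps $\partial:\widetilde P_{q+1}\to\widetilde P_q$ by $\partial(e(\emptyset,\widetilde{\mathsf m}))=\widetilde{\mathsf m}$ for $q=0$ and, for $q\ge1$, $$\partial(e(\widetilde F,\widetilde{\mathsf m}))=\sum_{r=1}^q(-1)^r x_{i_r,j_r}\,e(\widetilde F_r,\widetilde{\mathsf m})-\sum_{r\in B(\widetilde F,\widetilde{\mathsf m})}(-1)^r\,\frac{x_{i_r,j_r}\,\widetilde{\mathsf m}}{\widetilde{\mathsf m}_{\langle i_r\rangle}}\,e(\widetilde F_r,\widetilde{\mathsf m}_{\langle i_r\rangle}).$$ Then $\widetilde P_\bullet:\ \cdots\xrightarrow{\partial}\widetilde P_2\xrightarrow{\partial}\widetilde P_1\xrightarrow{\partial}\widetilde P_0\to0$ is a $\mathbb Z^{n\times d}$-graded minimal free $\widetilde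 S$-resolution of $\widetilde S/\text{b-pol}(I)$. -/

import Mathlib

/-! ## Multigraded minimal free resolutions over a polynomial ring -/

section GradedResolution

open MvPolynomial

/-- The weights of the fine grading of `k[x_s | s ∈ σ]` by `ℤ^σ`: the variable `x_s` has degree
the `s`-th unit vector. -/
def fineWeight (σ : Type*) [DecidableEq σ] (s : σ) : σ → ℤ := Pi.single s 1

/-- The integer vector of an exponent vector. -/
def expVec {σ : Type*} (u : σ →₀ ℕ) : σ → ℤ := fun s => (u s : ℤ)

/-- In the free module with basis `e_b`, `b ∈ ι`, where `e_b` has degree `deg b ∈ ℤ^σ`, the element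
`f = ∑ f_b e_b` is homogeneous of degree `a` when every coefficient `f_b` is homogeneous of degree
`a - deg b`. -/
def IsFineHomogeneous {k : Type*} [Field k] {σ : Type*} [DecidableEq σ] {ι : Type*}
    (deg : ι → σ → ℤ) (a : σ → ℤ) (f : ι →₀ MvPolynomial σ k) : Prop :=
  ∀ b, IsWeightedHomogeneous (fineWeight σ) (f b) (a - deg b)

/-- The sequence of based free modules
`⋯ → ⨁_{b ∈ ι 2} R e_b → ⨁_{b ∈ ι 1} R e_b → ⨁_{b ∈ ι 0} R e_b → R/J → 0`
over `R = k[x_s | s ∈ σ]`, with basis elements `e_b` in degree `deg q b ∈ ℤ^σ`, differentials `∂`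
and augmentation `ε`, is a `ℤ^σ`-graded minimal free resolution of `R/J`. -/
structure IsMinimalGradedFreeResolution {k : Type*} [Field k] {σ : Type*} [DecidableEq σ]
    {ι : ℕ → Type*} (deg : ∀ q, ι q → σ → ℤ)
    (diff : ∀ q, (ι (q + 1) →₀ MvPolynomial σ k) →ₗ[MvPolynomial σ k] (ι q →₀ MvPolynomial σ k))
    (J : Ideal (MvPolynomial σ k))
    (aug : (ι 0 →₀ MvPolynomial σ k) →ₗ[MvPolynomial σ k] (MvPolynomial σ k ⧸ J)) : Prop where
  /-- Each free module is finitely generated. -/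
  finite : ∀ q, Finite (ι q)
  /-- `R/J` is a graded module. -/
  ideal_homogeneous : ∀ f ∈ J, ∀ a, weightedHomogeneousComponent (fineWeight σ) a f ∈ J
  /-- The differentials are graded of degree `0`. -/
  diff_homogeneous : ∀ q a f, IsFineHomogeneous (deg (q + 1)) a f →
    IsFineHomogeneous (deg q) a (diff q f)
  /-- The augmentation is graded of degree `0`. -/
  aug_homogeneous : ∀ a f, IsFineHomogeneous (deg 0) a f →
    ∃ p : MvPolynomial σ k, IsWeightedHomogeneous (fineWeight σ) p a ∧
      aug f = Ideal.Quotient.mk J p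
  /-- Exactness at `R/J`. -/
  aug_surjective : Function.Surjective aug
  /-- Exactness in homological degree `0`. -/
  exact_zero : Function.Exact (diff 0) aug
  /-- Exactness in positive homological degrees; in particular `∂ ∘ ∂ = 0`. -/
  exact_succ : ∀ q, Function.Exact (diff (q + 1)) (diff q)
  /-- Minimality: the image of `∂` lies in `𝔪` times the target, where `𝔪` is the ideal generated
  by all variables. -/
  minimal : ∀ q, LinearMap.range (diff q) ≤
    Ideal.span (Set.range (X : σ → MvPolynomial σ k)) •
      (⊤ : Submodule (MvPolynomial σ k) (ι q →₀ MvPolynomial σ k))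

end GradedResolution

/-! ## Borel fixed ideals

A monomial of `S = k[x_i | i ∈ Fin n]` is represented by its exponent vector `m : Fin n →₀ ℕ`, and
variables are numbered from `0`. -/

namespace BorelFixed

open MvPolynomial

noncomputable section

/-- An ideal generated by monomials. -/
def IsMonomialIdeal {k : Type*} [Field k] {σ : Type*} (I : Ideal (MvPolynomial σ k)) : Prop :=
  ∃ M : Set (σ →₀ ℕ), I = Ideal.span ((fun m => monomial m (1 : k)) '' M)

/-- `G(I)`: the minimal monomial generators of the monomial ideal `I`, that is, the monomials in `I`
that are minimal for divisibility. -/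
def minGens {k : Type*} [Field k] {n : ℕ} (I : Ideal (MvPolynomial (Fin n) k)) :
    Set (Fin n →₀ ℕ) :=
  {m | Minimal (fun u => monomial u (1 : k) ∈ I) m}

/-- Borel fixed (strongly stable) ideals: monomial ideals such that `m ∈ G(I)`, `x_i ∣ m` and `j < i`
imply `(x_j / x_i) m ∈ I`. -/
def IsBorelFixed {k : Type*} [Field k] {n : ℕ} (I : Ideal (MvPolynomial (Fin n) k)) : Prop :=
  IsMonomialIdeal I ∧ ∀ m ∈ minGens I, ∀ i j : Fin n, m i ≠ 0 → j < i →
    monomial (m - Finsupp.single i 1 + Finsupp.single j 1) (1 : k) ∈ I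

/-- `ν(m)`: the largest index of a variable dividing `m` (`⊥` for `m = 1`). -/
def nu {n : ℕ} (m : Fin n →₀ ℕ) : WithBot (Fin n) := m.support.max

/-- `m₁` is the generator in the canonical decomposition of `m`: `m = m₁ m₂` with `m₁ ∈ G(I)` and
every variable of `m₁` at most every variable of `m₂`. -/
def IsCanonicalGen {k : Type*} [Field k] {n : ℕ} (I : Ideal (MvPolynomial (Fin n) k))
    (m m₁ : Fin n →₀ ℕ) : Prop :=
  m₁ ∈ minGens I ∧ ∃ m₂ : Fin n →₀ ℕ, m = m₁ + m₂ ∧ ∀ i ∈ m₁.support, ∀ j ∈ m₂.support, i ≤ j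

open Classical in
/-- `g(m)`: the generator in the canonical decomposition of `m`. For a Borel fixed ideal it exists
and is unique for each monomial `m ∈ I`; the value `m` is used when there is none. -/
def canonicalGen {k : Type*} [Field k] {n : ℕ} (I : Ideal (MvPolynomial (Fin n) k))
    (m : Fin n →₀ ℕ) : Fin n →₀ ℕ :=
  if h : ∃ m₁, IsCanonicalGen I m m₁ then h.choose else m

/-- The indices greater than `i` of variables dividing `m`. -/
def laterVars {n : ℕ} (m : Fin n →₀ ℕ) (i : Fin n) : Finset (Fin n) :=
  m.support.filter (fun l => i < l)

/-- `𝔟_i(m) = (x_i / x_k) m` where `x_k` is the next variable after `x_i` that divides `m`; it is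
used for `i < ν(m)` only, that is, when there is such a `k`. -/
def bMove {n : ℕ} (m : Fin n →₀ ℕ) (i : Fin n) : Fin n →₀ ℕ :=
  if h : (laterVars m i).Nonempty then
    m - Finsupp.single ((laterVars m i).min' h) 1 + Finsupp.single i 1
  else m

open Classical in
/-- `m_⟨i⟩`: it is `g(𝔟_i(m))` if `i < ν(m)`, and `m` otherwise. -/
def angle {k : Type*} [Field k] {n : ℕ} (I : Ideal (MvPolynomial (Fin n) k))
    (m : Fin n →₀ ℕ) (i : Fin n) : Fin n →₀ ℕ :=
  if (i : WithBot (Fin n)) < nu m then canonicalGen I (bMove m i) else m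

/-! ## The alternative polarization

The variables `x_{i,j}` of `S̃` are indexed by `Fin n × Fin d`, both indices from `0`. -/

/-- `b-pol(m) = ∏ x_{i,j}` over the pairs with `a_0 + ⋯ + a_{i-1} ≤ j < a_0 + ⋯ + a_i`, for
`m = ∏ x_i^{a_i}` of degree at most `d`, as an exponent vector. -/
def bpolMon (d : ℕ) {n : ℕ} (m : Fin n →₀ ℕ) : Fin n × Fin d →₀ ℕ :=
  Finsupp.equivFunOnFinite.symm fun p =>
    if ∑ l ∈ Finset.Iio p.1, m l ≤ (p.2 : ℕ) ∧ (p.2 : ℕ) < ∑ l ∈ Finset.Iic p.1, m l then 1 else 0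

/-- `b-pol(I)`: the ideal generated by `b-pol(m)`, `m ∈ G(I)`. -/
def bpol {k : Type*} [Field k] (d : ℕ) {n : ℕ} (I : Ideal (MvPolynomial (Fin n) k)) :
    Ideal (MvPolynomial (Fin n × Fin d) k) :=
  Ideal.span ((fun m => monomial (bpolMon d m) (1 : k)) '' minGens I)

/-! ## The complex -/

/-- `(F, b-pol(m))` is admissible for `b-pol(I)`: `m ∈ G(I)`, and each `(i, j) ∈ F` satisfies
`i < ν(m)` and `j = a_0 + ⋯ + a_i` (with `j` counted from `0`). As `j` is determined by `i`, the
elements of `F` have distinct first entries. -/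
def Admissible {k : Type*} [Field k] {n d : ℕ} (I : Ideal (MvPolynomial (Fin n) k))
    (F : Finset (Fin n × Fin d)) (m : Fin n →₀ ℕ) : Prop :=
  m ∈ minGens I ∧ ∀ p ∈ F, (p.1 : WithBot (Fin n)) < nu m ∧ (p.2 : ℕ) = ∑ l ∈ Finset.Iic p.1, m l

theorem Admissible.erase {k : Type*} [Field k] {n d : ℕ} {I : Ideal (MvPolynomial (Fin n) k)}
    {F : Finset (Fin n × Fin d)} {m : Fin n →₀ ℕ} (h : Admissible I F m) (p : Fin n × Fin d) :
    Admissible I (F.erase p) m :=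
  ⟨h.1, fun p' hp' => h.2 p' (Finset.mem_of_mem_erase hp')⟩

/-- `A_q`: the admissible pairs with `#F = q`. -/
abbrev AdmPair {k : Type*} [Field k] {n : ℕ} (d : ℕ) (I : Ideal (MvPolynomial (Fin n) k)) (q : ℕ) :
    Type :=
  {s : Finset (Fin n × Fin d) × (Fin n →₀ ℕ) // Admissible I s.1 s.2 ∧ s.1.card = q}

/-- The index set of the basis of `P̃_q`: one element for `P̃_0 = S̃`, and `A_{q-1}` for `q ≥ 1`. -/
abbrev BasisIdx {k : Type*} [Field k] {n : ℕ} (d : ℕ) (I : Ideal (MvPolynomial (Fin n) k)) :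
    ℕ → Type
  | 0 => Unit
  | q + 1 => AdmPair d I q

/-- The degrees of the basis elements: `0` for `1 ∈ P̃_0`, and the degree of
`b-pol(m) ∏_{(i,j) ∈ F} x_{i,j}` for `e(F, b-pol(m))`. -/
def basisDeg {k : Type*} [Field k] {n : ℕ} (d : ℕ) (I : Ideal (MvPolynomial (Fin n) k)) :
    ∀ q, BasisIdx d I q → Fin n × Fin d → ℤ
  | 0 => fun _ => 0
  | _ + 1 => fun s => expVec (bpolMon d s.1.2 + ∑ p ∈ s.1.1, Finsupp.single p 1)

open Classical in
/-- The basis element `e(F, b-pol(m))` of `⨁_{A_q} S̃` (and `0` if the pair is not in `A_q`). -/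
def basisElt {k : Type*} [Field k] {n : ℕ} (d : ℕ) (I : Ideal (MvPolynomial (Fin n) k)) (q : ℕ)
    (F : Finset (Fin n × Fin d)) (m : Fin n →₀ ℕ) :
    AdmPair d I q →₀ MvPolynomial (Fin n × Fin d) k :=
  if h : Admissible I F m ∧ F.card = q then Finsupp.single ⟨(F, m), h⟩ 1 else 0

/-- For `F = {(i_1, j_1), …, (i_q, j_q)}` with `i_1 < ⋯ < i_q`, the position `r ∈ {1, …, q}` of
`p = (i_r, j_r)`. -/
def pos {n d : ℕ} (F : Finset (Fin n × Fin d)) (p : Fin n × Fin d) : ℕ :=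
  (F.filter (fun p' => p'.1 ≤ p.1)).card

open Classical in
/-- `B(F, b-pol(m))`, as the set of the elements `(i_r, j_r)` of `F` such that
`(F \ {(i_r, j_r)}, b-pol(m_⟨i_r⟩))` is admissible. -/
def bSet {k : Type*} [Field k] {n d : ℕ} (I : Ideal (MvPolynomial (Fin n) k))
    (F : Finset (Fin n × Fin d)) (m : Fin n →₀ ℕ) : Finset (Fin n × Fin d) :=
  F.filter (fun p => Admissible I (F.erase p) (angle I m p.1))

/-- The value of the differential at `e(F, b-pol(m))` for `#F = q + 1`. -/
def diffElt {k : Type*} [Field k] {n : ℕ} (d : ℕ) (I : Ideal (MvPolynomial (Fin n) k)) (q : ℕ)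
    (F : Finset (Fin n × Fin d)) (m : Fin n →₀ ℕ) :
    AdmPair d I q →₀ MvPolynomial (Fin n × Fin d) k :=
  ∑ p ∈ F, ((-1) ^ pos F p * X p : MvPolynomial (Fin n × Fin d) k) •
      basisElt d I q (F.erase p) m
    - ∑ p ∈ bSet I F m,
      ((-1) ^ pos F p *
        monomial (Finsupp.single p 1 + bpolMon d m - bpolMon d (angle I m p.1)) (1 : k) :
        MvPolynomial (Fin n × Fin d) k) •
      basisElt d I q (F.erase p) (angle I m p.1)

/-- The differential `∂ : P̃_{q+1} → P̃_q`. On `P̃_1` it is `e(∅, b-pol(m)) ↦ b-pol(m)`. -/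
def diff {k : Type*} [Field k] {n : ℕ} (d : ℕ) (I : Ideal (MvPolynomial (Fin n) k)) :
    ∀ q, (BasisIdx d I (q + 1) →₀ MvPolynomial (Fin n × Fin d) k)
      →ₗ[MvPolynomial (Fin n × Fin d) k] (BasisIdx d I q →₀ MvPolynomial (Fin n × Fin d) k)
  | 0 => Finsupp.linearCombination _ fun s : AdmPair d I 0 =>
      (Finsupp.single () (monomial (bpolMon d s.1.2) (1 : k)) :
        Unit →₀ MvPolynomial (Fin n × Fin d) k)
  | q + 1 => Finsupp.linearCombination _ fun s : AdmPair d I (q + 1) =>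
      diffElt d I q s.1.1 s.1.2

/-- The augmentation: the quotient map `P̃_0 = S̃ → S̃ / b-pol(I)`. -/
def aug {k : Type*} [Field k] {n : ℕ} (d : ℕ) (I : Ideal (MvPolynomial (Fin n) k)) :
    (BasisIdx d I 0 →₀ MvPolynomial (Fin n × Fin d) k)
      →ₗ[MvPolynomial (Fin n × Fin d) k] (MvPolynomial (Fin n × Fin d) k ⧸ bpol d I) :=
  Finsupp.linearCombination _ fun _ : Unit =>
    Ideal.Quotient.mk (bpol d I) 1

end

end BorelFixed

/-! Read a monomial as the weakly increasing word of its variables. The partial sum `psum m t`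
counts the letters of index below t, and b-pol records letters with their positions: x_{i,j} divides
b-pol(m) exactly when letter j of m is x_i. Strong stability makes I closed under passing to words
with larger partial sums (`IsBorelFixed.mem_of_psum_le`). Hence g(m) is the shortest prefix of m in
I, and m_⟨i⟩ arises by rewriting the first letter beyond x_i as x_i and then cutting to a prefix
(`IsBorelFixed.isAngle`). Identities between such generators become identities between minima and
maxima of partial sums.

∂² = 0 holds because removing two elements of F in either order gives the same contribution
(`cross_comm`) with opposite signs (`sign_swap`).

For exactness, order the generators lexicographically. Since m_⟨i⟩ is larger than m
(`IsAngle.toLex_lt`), ∂ is triangular: its leading part is, for each m, the Koszul differential on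
the variables movable in m. The set of movable variables dividing x^u ∏_{p ∈ F} x_p is unchanged by
that leading part, so one element p of it can be chosen coherently, and the Koszul homotopy shifts
x_p from x^u into F. Terms with p already in F, or with no movable variable at all, are the normal
forms. They span modulo boundaries (`monomial_smul_basisElt_mem`), and ∂ is injective on their
combinations (`eq_zero_of_diffMap_eq_zero`, `eq_zero_of_diffGens_eq_zero`). A cycle is therefore a
boundary plus a normal cycle, which vanishes.

Minimality is a degree count: deg m_⟨i⟩ ≤ deg m, so no coefficient of ∂ is a unit. -/

namespace BorelFixed

open MvPolynomial

/-! ### Monomials as words: partial sums, prefixes and the move 𝔟_i. -/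

section PartialSums

variable {n : ℕ}

/-- The partial sum `a_0 + ⋯ + a_{t-1}` of the exponents of a monomial. -/
def psum (m : Fin n →₀ ℕ) (t : ℕ) : ℕ := ∑ l with (l : Fin n).val < t, m l

theorem psum_zero (m : Fin n →₀ ℕ) : psum m 0 = 0 := by simp [psum]

theorem psum_succ (m : Fin n →₀ ℕ) (i : Fin n) : psum m (i + 1) = psum m i + m i := by
  unfold psum
  have : (Finset.univ.filter fun l : Fin n => l.val < i + 1) =
      insert i (Finset.univ.filter fun l : Fin n => l.val < i) := by
    ext l
    simp only [Finset.mem_filter, Finset.mem_univ, true_and, Finset.mem_insert, Fin.ext_iff]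
    omega
  rw [this, Finset.sum_insert (by simp), add_comm]

theorem psum_mono (m : Fin n →₀ ℕ) : Monotone (psum m) := by
  intro s t h
  refine Finset.sum_le_sum_of_subset fun l hl => ?_
  simp only [Finset.mem_filter, Finset.mem_univ, true_and] at hl ⊢
  omega

theorem psum_of_le (m : Fin n →₀ ℕ) {t : ℕ} (h : n ≤ t) : psum m t = m.degree := by
  rw [Finsupp.degree_eq_sum, psum, Finset.filter_true_of_mem]
  intro l _
  omega

theorem psum_le_degree (m : Fin n →₀ ℕ) (t : ℕ) : psum m t ≤ m.degree := by
  rcases le_total n t with h | h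
  · exact (psum_of_le m h).le
  · exact (psum_mono m h).trans (psum_of_le m le_rfl).le

theorem psum_add (m m' : Fin n →₀ ℕ) (t : ℕ) : psum (m + m') t = psum m t + psum m' t := by
  simp [psum, Finset.sum_add_distrib]

theorem psum_single (i : Fin n) (t : ℕ) :
    psum (Finsupp.single i 1) t = if i.val < t then 1 else 0 := by
  simp only [psum, Finsupp.single_apply]
  rw [Finset.sum_ite_eq]
  simp

theorem sum_Iic_eq_psum (m : Fin n →₀ ℕ) (i : Fin n) :
    ∑ l ∈ Finset.Iic i, m l = psum m (i + 1) := by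
  refine Finset.sum_congr ?_ fun _ _ => rfl
  ext l
  simp only [Finset.mem_Iic, Finset.mem_filter, Finset.mem_univ, true_and, Fin.le_def]
  omega

theorem sum_Iio_eq_psum (m : Fin n →₀ ℕ) (i : Fin n) :
    ∑ l ∈ Finset.Iio i, m l = psum m i := by
  refine Finset.sum_congr ?_ fun _ _ => rfl
  ext l
  simp

theorem ext_psum {m m' : Fin n →₀ ℕ} (h : ∀ t ≤ n, psum m t = psum m' t) : m = m' := by
  ext i
  have h1 := psum_succ m i
  have h2 := psum_succ m' i
  have h3 := h i i.2.le
  have h4 := h (i + 1) i.2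
  omega

theorem psum_le_of_le {m m' : Fin n →₀ ℕ} (h : m ≤ m') (t : ℕ) : psum m t ≤ psum m' t :=
  Finset.sum_le_sum fun l _ => h l

/-- The product of the first `L` letters of the monomial `m`, written as a weakly increasing
word in the variables. -/
noncomputable def trunc (m : Fin n →₀ ℕ) (L : ℕ) : Fin n →₀ ℕ :=
  Finsupp.equivFunOnFinite.symm fun l => min (psum m (l + 1)) L - min (psum m l) L

theorem psum_trunc (m : Fin n →₀ ℕ) (L t : ℕ) : psum (trunc m L) t = min (psum m t) L := by
  have key : ∀ t ≤ n, psum (trunc m L) t = min (psum m t) L := by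
    intro t
    induction t with
    | zero => simp [psum_zero]
    | succ t ih =>
      intro h
      have h1 := psum_succ (trunc m L) ⟨t, h⟩
      have h2 : trunc m L ⟨t, h⟩ = min (psum m (t + 1)) L - min (psum m t) L := rfl
      have h3 := ih (by omega)
      have h4 := psum_mono m (Nat.le_succ t)
      simp only [Nat.succ_eq_add_one] at h1 h4
      omega
  rcases le_total t n with h | h
  · exact key t h
  · rw [psum_of_le _ h, psum_of_le _ h, ← psum_of_le _ le_rfl, key n le_rfl, psum_of_le _ le_rfl]

theorem degree_trunc (m : Fin n →₀ ℕ) (L : ℕ) : (trunc m L).degree = min m.degree L := by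
  rw [← psum_of_le _ le_rfl, psum_trunc, psum_of_le _ le_rfl]

theorem trunc_le (m : Fin n →₀ ℕ) (L : ℕ) : trunc m L ≤ m := by
  intro l
  have h1 : trunc m L l = min (psum m (l + 1)) L - min (psum m l) L := rfl
  have h2 := psum_succ m l
  omega

theorem lt_nu_iff (m : Fin n →₀ ℕ) (i : Fin n) :
    (i : WithBot (Fin n)) < nu m ↔ psum m (i + 1) < m.degree := by
  have h1 : (i : WithBot (Fin n)) < nu m ↔ ∃ l ∈ m.support, i < l := by
    unfold nu
    constructor
    · intro h
      obtain ⟨l, hl⟩ : ∃ l : Fin n, m.support.max = l := by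
        rcases hm : m.support.max with _ | l
        · rw [hm] at h
          exact absurd h not_lt_bot
        · exact ⟨l, rfl⟩
      refine ⟨l, Finset.mem_of_max hl, ?_⟩
      rw [hl] at h
      exact_mod_cast h
    · rintro ⟨l, hl, hil⟩
      exact lt_of_lt_of_le (by exact_mod_cast hil) (Finset.le_max hl)
  have h2 : psum m (i + 1) + ∑ l with ¬ (l : Fin n).val < i + 1, m l = m.degree := by
    rw [Finsupp.degree_eq_sum, psum, Finset.sum_filter_add_sum_filter_not]
  rw [h1]
  constructor
  · rintro ⟨l, hl, hil⟩
    have : m l ≤ ∑ l with ¬ (l : Fin n).val < i + 1, m l :=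
      Finset.single_le_sum (f := fun l => m l) (fun _ _ => Nat.zero_le _) (by
        simp only [Finset.mem_filter, Finset.mem_univ, true_and]
        have := Fin.lt_def.1 hil
        omega)
    have := Finsupp.mem_support_iff.1 hl
    omega
  · intro h
    obtain ⟨l, hl, hl0⟩ := Finset.exists_ne_zero_of_sum_ne_zero
      (show ∑ l with ¬ (l : Fin n).val < i + 1, m l ≠ 0 by omega)
    refine ⟨l, Finsupp.mem_support_iff.2 hl0, ?_⟩
    simp only [Finset.mem_filter, Finset.mem_univ, true_and] at hl
    exact Fin.lt_def.2 (by omega)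

/-- The move turns letter number `psum m (i + 1)`, counted from 0, which is the first one beyond
x_i, into x_i. No letter has index strictly between i and k, so the partial sums with i < t ≤ k rise
by one from their common value; the maximum leaves the later ones alone. -/
theorem psum_bMove {m : Fin n →₀ ℕ} {i : Fin n} (h : psum m (i + 1) < m.degree) (t : ℕ) :
    psum (bMove m i) t =
      if i.val < t then max (psum m t) (psum m (i + 1) + 1) else psum m t := by
  have hne : (laterVars m i).Nonempty := by
    have h1 := (lt_nu_iff m i).2 h
    by_contra hc
    rw [Finset.not_nonempty_iff_eq_empty, laterVars, Finset.filter_eq_empty_iff] at hc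
    refine absurd h1 (not_lt.2 (Finset.max_le fun l hl => ?_))
    exact_mod_cast not_lt.1 (hc hl)
  rw [bMove, dif_pos hne]
  set k := (laterVars m i).min' hne with hk
  have hkm := Finset.min'_mem _ hne
  rw [← hk, laterVars, Finset.mem_filter, Finsupp.mem_support_iff] at hkm
  have hik := Fin.lt_def.1 hkm.2
  have hzero : ∀ s ≤ k.val, psum m s ≤ psum m (i + 1) := by
    intro s
    induction s with
    | zero => simp [psum_zero]
    | succ s ih =>
      intro hs
      by_cases his : s ≤ i
      · exact psum_mono m (by omega)
      have h1 := psum_succ m ⟨s, by omega⟩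
      have h2 : m ⟨s, by omega⟩ = 0 := by
        by_contra hc
        have : k ≤ ⟨s, by omega⟩ := Finset.min'_le _ _ (by
          rw [laterVars, Finset.mem_filter, Finsupp.mem_support_iff]
          exact ⟨hc, Fin.lt_def.2 (by simpa using his)⟩)
        have := Fin.le_def.1 this
        simp only at this
        omega
      have h3 := ih (by omega)
      simp only at h1
      omega
  have hle : Finsupp.single k 1 ≤ m := by
    rw [Finsupp.single_le_iff]
    omega
  have h1 : psum (m - Finsupp.single k 1) t + psum (Finsupp.single k 1) t = psum m t := by
    rw [← psum_add, tsub_add_cancel_of_le hle]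
  rw [psum_add, psum_single]
  rw [psum_single] at h1
  have h2 := psum_succ m k
  rcases lt_or_ge k.val t with hkt | hkt
  · have h3 := psum_mono m (show k.val + 1 ≤ t by omega)
    have h4 := psum_mono m (show i.val + 1 ≤ k by omega)
    simp only [hkt, if_true, show i.val < t by omega] at h1 ⊢
    omega
  · have h3 := hzero t hkt
    simp only [not_lt.2 hkt, if_false] at h1
    split_ifs with hit
    · have h4 := psum_mono m (show i.val + 1 ≤ t by omega)
      omega
    · omega

end PartialSums

/-! ### Domination of words, canonical decompositions and the generators m_⟨i⟩. -/

section Generators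

variable {k : Type*} [Field k] {n : ℕ} {I : Ideal (MvPolynomial (Fin n) k)}

theorem monomial_mem_of_le {u v : Fin n →₀ ℕ} (hu : monomial u (1 : k) ∈ I) (h : u ≤ v) :
    monomial v (1 : k) ∈ I := by
  have : monomial v (1 : k) = monomial (v - u) 1 * monomial u 1 := by
    rw [monomial_mul, tsub_add_cancel_of_le h, one_mul]
  rw [this]
  exact I.mul_mem_left _ hu

theorem exists_minGens_le {u : Fin n →₀ ℕ} (hu : monomial u (1 : k) ∈ I) :
    ∃ g ∈ minGens I, g ≤ u := by
  obtain ⟨g, hg, hmin⟩ :=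
    exists_minimal_le_of_wellFoundedLT (fun u => monomial u (1 : k) ∈ I) u hu
  exact ⟨g, hmin, hg⟩

theorem IsBorelFixed.move_mem (hI : IsBorelFixed I) {u : Fin n →₀ ℕ}
    (hu : monomial u (1 : k) ∈ I) {i j : Fin n} (hij : j < i) :
    monomial (u - Finsupp.single i 1 + Finsupp.single j 1) (1 : k) ∈ I := by
  obtain ⟨g, hg, hgu⟩ := exists_minGens_le hu
  by_cases hgi : g i = 0
  · refine monomial_mem_of_le hg.1 fun l => ?_
    have := hgu l
    simp only [Finsupp.coe_add, Finsupp.coe_tsub, Pi.add_apply, Pi.sub_apply,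
      Finsupp.single_apply]
    by_cases hl : i = l
    · subst hl
      omega
    · simp only [hl, if_false]
      omega
  · refine monomial_mem_of_le (hI.2 g hg i j hgi hij) ?_
    gcongr

/-- The word u is carried to v by elementary steps that each raise one partial sum by one, so
induction on the total gap applies. -/
theorem IsBorelFixed.mem_of_psum_le (hI : IsBorelFixed I) {u v : Fin n →₀ ℕ}
    (hu : monomial u (1 : k) ∈ I) (h : ∀ t ≤ n, psum u t ≤ psum v t) :
    monomial v (1 : k) ∈ I := by
  induction hN : ∑ t ∈ Finset.range (n + 1), (psum v t - psum u t) using Nat.strong_induction_on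
    generalizing u with
  | _ N ih =>
  by_cases hS : ∃ t ≤ n, psum u t < psum v t
  · obtain ⟨t, ⟨htn, htl⟩, hmax⟩ : ∃ t, (t ≤ n ∧ psum u t < psum v t) ∧
        ∀ s ≤ n, t < s → psum u s = psum v s := by
      classical
      set S := (Finset.range (n + 1)).filter fun t => psum u t < psum v t with hSdef
      have hSne : S.Nonempty := by
        obtain ⟨t, h1, h2⟩ := hS
        exact ⟨t, by simp [hSdef, h2]; omega⟩
      have h1 := Finset.mem_filter.1 (S.max'_mem hSne)
      rw [Finset.mem_range] at h1
      refine ⟨S.max' hSne, ⟨by omega, h1.2⟩, fun s hs hlt => ?_⟩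
      by_contra hc
      have h3 : s ∈ S := by
        rw [hSdef, Finset.mem_filter, Finset.mem_range]
        exact ⟨by omega, lt_of_le_of_ne (h s hs) hc⟩
      have h4 := S.le_max' s h3
      omega
    obtain ⟨r, rfl⟩ : ∃ r, t = r + 1 := by
      rcases t with _ | r
      · simp [psum_zero] at htl
      · exact ⟨r, rfl⟩
    obtain ⟨u', hu', hsum⟩ : ∃ u' : Fin n →₀ ℕ, monomial u' (1 : k) ∈ I ∧
        ∀ s ≤ n, psum u' s = psum u s + if s = r + 1 then 1 else 0 := by
      rcases Nat.lt_or_ge (r + 1) n with hr | hr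
      -- By maximality of t = r + 1 the next partial sums agree, so u must contain x_{r+1}.
      -- Replacing it by x_r changes the partial sum at r + 1 only. When r + 1 = n, multiplying by
      -- the last variable does the same.
      · have hpos : u ⟨r + 1, hr⟩ ≠ 0 := by
          have h1 := psum_succ u ⟨r + 1, hr⟩
          have h2 := hmax (r + 1 + 1) (by omega) (by omega)
          have h3 := psum_mono v (Nat.le_succ (r + 1))
          simp only [Nat.succ_eq_add_one] at h1 h3
          omega
        refine ⟨_, hI.move_mem hu (i := ⟨r + 1, hr⟩) (j := ⟨r, by omega⟩) (Fin.lt_def.2 (by simp)),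
          fun s hs => ?_⟩
        have hle : Finsupp.single (⟨r + 1, hr⟩ : Fin n) 1 ≤ u := by
          rw [Finsupp.single_le_iff]
          omega
        have h1 : psum (u - Finsupp.single (⟨r + 1, hr⟩ : Fin n) 1) s +
            psum (Finsupp.single (⟨r + 1, hr⟩ : Fin n) 1) s = psum u s := by
          rw [← psum_add, tsub_add_cancel_of_le hle]
        rw [psum_add, psum_single]
        rw [psum_single] at h1
        simp only at h1 ⊢
        split_ifs at h1 ⊢ <;> omega
      · refine ⟨u + Finsupp.single ⟨r, by omega⟩ 1, monomial_mem_of_le hu (by simp),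
          fun s hs => ?_⟩
        rw [psum_add, psum_single]
        simp only
        split_ifs <;> omega
    refine ih _ ?_ hu' (fun s hs => ?_) rfl
    · rw [← hN]
      refine Finset.sum_lt_sum (fun s hs => ?_) ⟨r + 1, by simp; omega, ?_⟩
      · rw [hsum s (by simpa [Nat.lt_succ_iff] using hs)]
        omega
      · rw [hsum _ htn, if_pos rfl]
        omega
    · rw [hsum s hs]
      have := h s hs
      split_ifs with hsr
      · subst hsr
        omega
      · omega
  · push Not at hS
    rwa [← ext_psum fun t ht => le_antisymm (h t ht) (hS t ht)]

theorem eq_of_mem_minGens_of_le {g u : Fin n →₀ ℕ} (hg : g ∈ minGens I)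
    (hu : monomial u (1 : k) ∈ I) (h : u ≤ g) : u = g :=
  le_antisymm h (hg.2 hu h)

/-- A minimal generator is the shortest element of `I` among the words that dominate it. -/
theorem IsBorelFixed.degree_le_of_psum_le (hI : IsBorelFixed I) {g u : Fin n →₀ ℕ}
    (hg : g ∈ minGens I) (hu : monomial u (1 : k) ∈ I) (h : ∀ t ≤ n, psum u t ≤ psum g t) :
    g.degree ≤ u.degree := by
  have h1 : monomial (trunc g u.degree) (1 : k) ∈ I := hI.mem_of_psum_le hu fun t ht => by
    rw [psum_trunc]
    exact le_min (h t ht) (psum_le_degree u t)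
  have h2 := congrArg Finsupp.degree (eq_of_mem_minGens_of_le hg h1 (trunc_le _ _))
  rw [degree_trunc] at h2
  omega

/-- A divisor u of v in I is dominated by the prefix of v of length deg u, so minimality need only
be tested on prefixes. -/
theorem IsBorelFixed.mem_minGens (hI : IsBorelFixed I) {v : Fin n →₀ ℕ}
    (hv : monomial v (1 : k) ∈ I) (h : ∀ L < v.degree, monomial (trunc v L) (1 : k) ∉ I) :
    v ∈ minGens I := by
  refine ⟨hv, fun u hu huv => ?_⟩
  have h1 : monomial (trunc v u.degree) (1 : k) ∈ I := hI.mem_of_psum_le hu fun t _ => by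
    rw [psum_trunc]
    exact le_min (psum_le_of_le huv t) (psum_le_degree u t)
  have h2 : v.degree ≤ u.degree := not_lt.1 fun hlt => h _ hlt h1
  have h3 : u + (v - u) = v := add_tsub_cancel_of_le huv
  have h4 := congrArg Finsupp.degree h3
  rw [map_add] at h4
  have h5 : (v - u).degree = 0 := by omega
  rw [Finsupp.degree_eq_zero_iff] at h5
  rw [← h3, h5, add_zero]

/-- The order condition makes m₁ a prefix of m: as long as m₁ is not exhausted, m₂ contributes no
letter. -/
theorem IsCanonicalGen.psum_eq {m m₁ : Fin n →₀ ℕ} (h : IsCanonicalGen I m m₁) (t : ℕ) :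
    psum m₁ t = min (psum m t) m₁.degree := by
  obtain ⟨_, m₂, rfl, hle⟩ := h
  rw [psum_add]
  have h1 := psum_le_degree m₁ t
  by_cases ht : psum m₁ t = m₁.degree
  · omega
  · have : psum m₂ t = 0 := by
      refine Finset.sum_eq_zero fun j hj => ?_
      by_contra hj0
      refine ht (le_antisymm h1 ?_)
      rw [← psum_of_le m₁ (le_refl n)]
      refine Finset.sum_le_sum_of_ne_zero fun i _ hi => ?_
      have h2 := Fin.le_def.1 (hle i (Finsupp.mem_support_iff.2 hi) j
        (Finsupp.mem_support_iff.2 hj0))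
      simp only [Finset.mem_filter, Finset.mem_univ, true_and] at hj ⊢
      omega
    omega

theorem isCanonicalGen_trunc {m : Fin n →₀ ℕ} {L : ℕ} (h : trunc m L ∈ minGens I) :
    IsCanonicalGen I m (trunc m L) := by
  refine ⟨h, m - trunc m L, (add_tsub_cancel_of_le (trunc_le _ _)).symm, fun i hi j hj => ?_⟩
  rw [Finsupp.mem_support_iff] at hi hj
  rw [Finsupp.tsub_apply] at hj
  have h1 : ∀ l, trunc m L l = min (psum m (l + 1)) L - min (psum m l) L := fun _ => rfl
  have h2 := psum_succ m i
  have h3 := psum_succ m j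
  rw [h1] at hi hj
  by_contra hc
  have h4 := psum_mono m (show j.val + 1 ≤ i by
    have := Fin.lt_def.1 (not_le.1 hc)
    omega)
  omega

/-- The generator is the shortest prefix of m that lies in I. -/
theorem IsBorelFixed.exists_isCanonicalGen (hI : IsBorelFixed I) {m : Fin n →₀ ℕ}
    (hm : monomial m (1 : k) ∈ I) : ∃ m₁, IsCanonicalGen I m m₁ := by
  classical
  have hex : ∃ L, monomial (trunc m L) (1 : k) ∈ I := by
    refine ⟨m.degree, hI.mem_of_psum_le hm fun t _ => ?_⟩
    rw [psum_trunc, min_eq_left (psum_le_degree _ _)]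
  refine ⟨_, isCanonicalGen_trunc (hI.mem_minGens (Nat.find_spec hex) fun L hL hmem => ?_)⟩
  rw [degree_trunc] at hL
  refine Nat.find_min hex (show L < Nat.find hex by omega) (hI.mem_of_psum_le hmem fun t _ => ?_)
  rw [psum_trunc, psum_trunc, psum_trunc]
  omega

theorem IsBorelFixed.isCanonicalGen_canonicalGen (hI : IsBorelFixed I) {m : Fin n →₀ ℕ}
    (hm : monomial m (1 : k) ∈ I) : IsCanonicalGen I m (canonicalGen I m) := by
  have h := hI.exists_isCanonicalGen hm
  rw [canonicalGen, dif_pos h]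
  exact h.choose_spec

/-- Two generators that are prefixes of one word coincide, since the shorter divides the longer. The
word is given only by its partial sums c, which need not come from an actual monomial; this is the
tool for comparing iterated ⟨i⟩. -/
theorem eq_of_psum_eq_min (c : ℕ → ℕ) {g g' : Fin n →₀ ℕ} (hg : g ∈ minGens I)
    (hg' : g' ∈ minGens I) (h : ∀ t ≤ n, psum g t = min (c t) g.degree)
    (h' : ∀ t ≤ n, psum g' t = min (c t) g'.degree) : g = g' := by
  have key : ∀ {a b : Fin n →₀ ℕ}, a ∈ minGens I → b ∈ minGens I →
      (∀ t ≤ n, psum a t = min (c t) a.degree) → (∀ t ≤ n, psum b t = min (c t) b.degree) →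
      a.degree ≤ b.degree → a = b := by
    intro a b ha hb h1 h2 hle
    have : a = trunc b a.degree := ext_psum fun t ht => by
      rw [psum_trunc, h1 t ht, h2 t ht]
      omega
    exact eq_of_mem_minGens_of_le hb ha.1 (this ▸ trunc_le _ _)
  rcases le_total g.degree g'.degree with hle | hle
  · exact key hg hg' h h' hle
  · exact (key hg' hg h' h hle).symm

/-- Dickson's lemma. -/
theorem finite_minGens (I : Ideal (MvPolynomial (Fin n) k)) : (minGens I).Finite := by
  have h1 : IsAntichain (· ≤ ·) (minGens I) := by
    intro a ha b hb hab hle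
    exact hab (eq_of_mem_minGens_of_le hb ha.1 hle)
  exact h1.finite_of_wellQuasiOrdered (wellQuasiOrdered_le)

/-- The properties that determine `m_⟨i⟩` for `i < ν(m)`, in terms of partial sums. -/
structure IsAngle (I : Ideal (MvPolynomial (Fin n) k)) (m : Fin n →₀ ℕ) (i : Fin n)
    (g : Fin n →₀ ℕ) : Prop where
  mem : g ∈ minGens I
  psum_eq : ∀ t, psum g t =
    min (if i.val < t then max (psum m t) (psum m (i + 1) + 1) else psum m t) g.degree
  lt_degree : psum m (i + 1) < g.degree
  degree_le : g.degree ≤ m.degree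

theorem IsBorelFixed.isAngle (hI : IsBorelFixed I) {m : Fin n →₀ ℕ} (hm : m ∈ minGens I)
    {i : Fin n} (hi : psum m (i + 1) < m.degree) : IsAngle I m i (angle I m i) := by
  rw [angle, if_pos ((lt_nu_iff m i).2 hi)]
  have hmem : monomial (bMove m i) (1 : k) ∈ I := hI.mem_of_psum_le hm.1 fun t _ => by
    rw [psum_bMove hi]
    split_ifs <;> omega
  have h := hI.isCanonicalGen_canonicalGen hmem
  set g := canonicalGen I (bMove m i)
  have hs : ∀ t, psum g t =
      min (if i.val < t then max (psum m t) (psum m (i + 1) + 1) else psum m t) g.degree := by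
    intro t
    rw [h.psum_eq, psum_bMove hi]
  -- The cut keeps the rewritten letter: otherwise g would be dominated by m and shorter than m.
  have hlt : psum m (i + 1) < g.degree := by
    by_contra hc
    have := hI.degree_le_of_psum_le hm h.1.1 fun t _ => by
      rw [hs]
      split_ifs with hit
      · have := psum_mono m (show i.val + 1 ≤ t by omega)
        omega
      · omega
    omega
  refine ⟨h.1, hs, hlt, ?_⟩
  have h1 := hs n
  rw [psum_of_le _ le_rfl, psum_of_le _ le_rfl, if_pos i.2] at h1
  omega

/-- Exponents before i are unchanged, and the one at i grows because the cut keeps the new letter.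
This makes ∂ triangular. -/
theorem IsAngle.toLex_lt {m g : Fin n →₀ ℕ} {i : Fin n} (h : IsAngle I m i g) :
    toLex m < toLex g := by
  have h0 : ∀ t ≤ i.val, psum g t = psum m t := by
    intro t ht
    have h1 := h.psum_eq t
    have h2 := psum_mono m (show t ≤ i + 1 by omega)
    have h3 := h.lt_degree
    rw [if_neg (by omega)] at h1
    omega
  refine Finsupp.Lex.lt_iff.2 ⟨i, fun j hj => ?_, ?_⟩
  · have hj' := Fin.lt_def.1 hj
    have h1 := psum_succ m j
    have h2 := psum_succ g j
    have h3 := h0 (j + 1) (by omega)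
    have h4 := h0 j (by omega)
    change m j = g j
    omega
  · have h1 := psum_succ m i
    have h2 := psum_succ g i
    have h3 := h0 i le_rfl
    have h4 := h.psum_eq (i + 1)
    have h5 := h.lt_degree
    rw [if_pos (by omega)] at h4
    change m i < g i
    omega

/-- The two orders of applying `⟨i⟩` and `⟨i'⟩`, `i < i'`, agree when `i'` stays in the same
position after applying `⟨i⟩`. -/
theorem angle_comm {m a a' b b' : Fin n →₀ ℕ} {i i' : Fin n} (hii : i < i')
    (ha : IsAngle I m i a) (ha' : IsAngle I a i' a') (hb : IsAngle I m i' b)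
    (hb' : IsAngle I b i b') (h : psum a (i' + 1) = psum m (i' + 1)) : a' = b' := by
  have hii' := Fin.lt_def.1 hii
  -- These are the partial sums after rewriting both letters and before any cut; both generators are
  -- prefixes of that word.
  refine eq_of_psum_eq_min (fun t => if i.val < t then max (if i'.val < t then
    max (psum m t) (psum m (i' + 1) + 1) else psum m t) (psum m (i + 1) + 1) else psum m t)
    ha'.mem hb'.mem (fun t _ => ?_) fun t _ => ?_
  · have h1 := ha.psum_eq t
    have h2 := ha'.psum_eq t
    have h4 := ha.psum_eq (i' + 1)
    have h5 := ha'.lt_degree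
    have h6 := ha'.degree_le
    rw [if_pos (by omega)] at h4
    split_ifs at * <;> omega
  · have h1 := hb.psum_eq t
    have h2 := hb'.psum_eq t
    have h3 := hb.psum_eq (i + 1)
    have h4 := hb.lt_degree
    have h5 := hb'.degree_le
    have h6 := psum_mono m (show i.val + 1 ≤ i' + 1 by omega)
    rw [if_neg (by omega)] at h3
    split_ifs at * <;> omega

/-- Applying `⟨i'⟩` before `⟨i⟩`, `i < i'`, has no effect when `⟨i⟩` moves the position of `i'` or
cuts it off. -/
theorem angle_absorb {m a b b' : Fin n →₀ ℕ} {i i' : Fin n} (hii : i < i')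
    (ha : IsAngle I m i a) (hb : IsAngle I m i' b) (hb' : IsAngle I b i b')
    (h : ¬ (psum a (i' + 1) = psum m (i' + 1) ∧ psum m (i' + 1) < a.degree)) : a = b' := by
  have hii' := Fin.lt_def.1 hii
  -- The same doubly rewritten word works: either both moves rewrite the same position and the
  -- smaller index i wins, or the position of i' lies beyond the end of a.
  refine eq_of_psum_eq_min (fun t => if i.val < t then max (if i'.val < t then
    max (psum m t) (psum m (i' + 1) + 1) else psum m t) (psum m (i + 1) + 1) else psum m t)
    ha.mem hb'.mem (fun t _ => ?_) fun t _ => ?_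
  · have h1 := ha.psum_eq t
    have h4 := ha.psum_eq (i' + 1)
    have h6 := psum_mono m (show i.val + 1 ≤ i' + 1 by omega)
    rw [if_pos (by omega)] at h4
    rcases lt_or_ge i'.val t with ht | ht
    · have h7 := psum_mono m (show i'.val + 1 ≤ t by omega)
      split_ifs at * <;> omega
    · split_ifs at * <;> omega
  · have h1 := hb.psum_eq t
    have h2 := hb'.psum_eq t
    have h3 := hb.psum_eq (i + 1)
    have h4 := hb.lt_degree
    have h5 := hb'.degree_le
    have h6 := psum_mono m (show i.val + 1 ≤ i' + 1 by omega)
    rw [if_neg (by omega)] at h3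
    split_ifs at * <;> omega

end Generators

/-! ### Movable variables, and divisibility between polarized generators. -/

section Admissible

variable {k : Type*} [Field k] {n d : ℕ} {I : Ideal (MvPolynomial (Fin n) k)}

/-- `({p}, b-pol(m))` satisfies the conditions on `p` in the definition of admissibility. -/
def IsMoveAt (m : Fin n →₀ ℕ) (p : Fin n × Fin d) : Prop :=
  psum m (p.1 + 1) = p.2 ∧ (p.2 : ℕ) < m.degree

theorem admissible_iff {F : Finset (Fin n × Fin d)} {m : Fin n →₀ ℕ} :
    Admissible I F m ↔ m ∈ minGens I ∧ ∀ p ∈ F, IsMoveAt m p := by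
  unfold Admissible IsMoveAt
  refine and_congr_right fun _ => forall₂_congr fun p _ => ?_
  rw [lt_nu_iff, sum_Iic_eq_psum]
  constructor
  · rintro ⟨h1, h2⟩
    exact ⟨h2.symm, h2 ▸ h1⟩
  · rintro ⟨h1, h2⟩
    exact ⟨h1 ▸ h2, h1.symm⟩

theorem IsMoveAt.eq_of_fst_eq {m : Fin n →₀ ℕ} {p p' : Fin n × Fin d} (h : IsMoveAt m p)
    (h' : IsMoveAt m p') (hp : p.1 = p'.1) : p = p' :=
  Prod.ext hp (Fin.ext (by rw [← h.1, ← h'.1, hp]))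

theorem IsMoveAt.isAngle (hI : IsBorelFixed I) {m : Fin n →₀ ℕ} (hm : m ∈ minGens I)
    {p : Fin n × Fin d} (hp : IsMoveAt m p) : IsAngle I m p.1 (angle I m p.1) :=
  hI.isAngle hm (hp.1 ▸ hp.2)

/-- A move of smaller index always survives ⟨i⟩; for larger indices this may fail, which is the
asymmetry treated in `cross_comm`. -/
theorem IsMoveAt.angle_of_lt {m a : Fin n →₀ ℕ} {i : Fin n} {p : Fin n × Fin d}
    (hp : IsMoveAt m p) (ha : IsAngle I m i a) (hpi : p.1 < i) : IsMoveAt a p := by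
  have hpi' := Fin.lt_def.1 hpi
  have h1 := ha.psum_eq (p.1 + 1)
  have h2 := psum_mono m (show p.1.val + 1 ≤ i + 1 by omega)
  have h3 := ha.lt_degree
  obtain ⟨h4, h5⟩ := hp
  rw [if_neg (by omega)] at h1
  constructor <;> omega

/-- Rewriting only raises partial sums, and the position of p is still inside b, so no cut has
affected it. The partial sum at p is thus squeezed between equal values. -/
theorem IsMoveAt.angle_of_angle {m a b : Fin n →₀ ℕ} {i i' : Fin n} {p : Fin n × Fin d}
    (hp : IsMoveAt m p) (ha : IsAngle I m i a) (hb : IsAngle I a i' b) (hpb : IsMoveAt b p) :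
    IsMoveAt a p := by
  obtain ⟨h1, h2⟩ := hp
  obtain ⟨h3, h4⟩ := hpb
  have h5 := ha.psum_eq (p.1 + 1)
  have h6 := hb.psum_eq (p.1 + 1)
  have h7 := hb.degree_le
  constructor <;> split_ifs at h5 h6 <;> omega

theorem bpolMon_apply (m : Fin n →₀ ℕ) (p : Fin n × Fin d) :
    bpolMon d m p = if psum m p.1 ≤ p.2 ∧ (p.2 : ℕ) < psum m (p.1 + 1) then 1 else 0 := by
  rw [← sum_Iic_eq_psum, ← sum_Iio_eq_psum]
  rfl

/-- The word a is a prefix of m with the single letter in position `p.2` replaced by x_i, where i is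
`p.1`. -/
theorem IsAngle.bpolMon_le {m a : Fin n →₀ ℕ} {p : Fin n × Fin d} (ha : IsAngle I m p.1 a)
    (hp : IsMoveAt m p) : bpolMon d a ≤ Finsupp.single p 1 + bpolMon d m := by
  intro r
  rw [Finsupp.add_apply, bpolMon_apply, bpolMon_apply, Finsupp.single_apply]
  obtain ⟨hp1, hp2⟩ := hp
  have h1 := ha.psum_eq r.1
  have h2 := ha.psum_eq (r.1 + 1)
  by_cases hr : psum a r.1 ≤ r.2 ∧ (r.2 : ℕ) < psum a (r.1 + 1)
  · rw [if_pos hr]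
    obtain ⟨hr1, hr2⟩ := hr
    by_cases hpr : p = r
    · rw [if_pos hpr]
      omega
    · rw [if_neg hpr, if_pos, zero_add]
      rcases lt_trichotomy p.1.val r.1.val with h | h | h
      · rw [if_pos h] at h1
        rw [if_pos (by omega)] at h2
        omega
      · rw [if_neg (by omega)] at h1
        rw [if_pos (by omega)] at h2
        have h3 : p.1 = r.1 := Fin.ext h
        have h4 : (p.2 : ℕ) ≠ r.2 := fun h4 => hpr (Prod.ext h3 (Fin.ext h4))
        rw [h3] at hp1 h2
        omega
      · rw [if_neg (by omega)] at h1
        rw [if_neg (by omega)] at h2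
        omega
  · rw [if_neg hr]
    omega

/-- The exponent vector of `x_p b-pol(m) / b-pol(m_⟨i⟩)`, where `p = (i, j)`. -/
noncomputable def shift (I : Ideal (MvPolynomial (Fin n) k)) (m : Fin n →₀ ℕ)
    (p : Fin n × Fin d) : Fin n × Fin d →₀ ℕ :=
  Finsupp.single p 1 + bpolMon d m - bpolMon d (angle I m p.1)

theorem shift_add (hI : IsBorelFixed I) {m : Fin n →₀ ℕ} (hm : m ∈ minGens I)
    {p : Fin n × Fin d} (hp : IsMoveAt m p) :
    shift I m p + bpolMon d (angle I m p.1) = Finsupp.single p 1 + bpolMon d m :=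
  tsub_add_cancel_of_le ((hp.isAngle hI hm).bpolMon_le hp)

theorem degree_bpolMon {m : Fin n →₀ ℕ} (hm : m.degree ≤ d) :
    (bpolMon d m).degree = m.degree := by
  rw [Finsupp.degree_eq_sum, Finsupp.degree_eq_sum, Fintype.sum_prod_type]
  refine Finset.sum_congr rfl fun i _ => ?_
  simp_rw [bpolMon_apply]
  rw [Finset.sum_boole]
  have h1 := psum_succ m i
  have h2 := psum_le_degree m (i + 1)
  have h3 : ((Finset.univ.filter fun j : Fin d => psum m i ≤ j ∧ j.val < psum m (i + 1)).map
      Fin.valEmbedding) = Finset.Ico (psum m i) (psum m (i + 1)) := by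
    ext j
    simp only [Finset.mem_map, Finset.mem_filter, Finset.mem_univ, true_and,
      Fin.valEmbedding_apply, Finset.mem_Ico]
    constructor
    · rintro ⟨j, hj, rfl⟩
      exact hj
    · intro hj
      exact ⟨⟨j, by omega⟩, hj, rfl⟩
  have h4 := congrArg Finset.card h3
  rw [Finset.card_map, Nat.card_Ico] at h4
  simp only [Nat.cast_id]
  rw [h4]
  omega

/-- Its degree is 1 + deg m - deg m_⟨i⟩, hence positive; this gives minimality. -/
theorem shift_ne_zero (hI : IsBorelFixed I) (hd : ∀ m ∈ minGens I, m.degree ≤ d)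
    {m : Fin n →₀ ℕ} (hm : m ∈ minGens I) {p : Fin n × Fin d} (hp : IsMoveAt m p) :
    shift I m p ≠ 0 := by
  intro h0
  have h1 := congrArg Finsupp.degree (shift_add hI hm hp)
  have ha := hp.isAngle hI hm
  have h2 := ha.degree_le
  rw [h0, zero_add, map_add, degree_bpolMon (hd _ ha.mem), degree_bpolMon (hd _ hm),
    Finsupp.degree_single] at h1
  omega

/-- If `m'` is lexicographically larger than `m`, then `b-pol(m')` is divisible by a variable that
can be moved in `m`. -/
theorem exists_isMoveAt_of_toLex_lt (hd : ∀ m ∈ minGens I, m.degree ≤ d)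
    {m m' : Fin n →₀ ℕ} (hm : m ∈ minGens I)
    (hm' : m' ∈ minGens I) (h : toLex m < toLex m') :
    ∃ p : Fin n × Fin d, IsMoveAt m p ∧ bpolMon d m' p ≠ 0 ∧ bpolMon d m p = 0 := by
  obtain ⟨i, hlt, hi⟩ := Finsupp.Lex.lt_iff.1 h
  have h0 : ∀ t ≤ i.val, psum m t = psum m' t := by
    intro t ht
    refine Finset.sum_congr rfl fun l hl => hlt l ?_
    simp only [Finset.mem_filter, Finset.mem_univ, true_and] at hl
    exact Fin.lt_def.2 (by omega)
  have hi' : m i < m' i := hi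
  have h1 := h0 i le_rfl
  have h2 := psum_succ m i
  have h3 := psum_succ m' i
  have h4 : psum m (i + 1) < m.degree := by
    by_contra hc
    -- Without a letter of m beyond the first difference i, the word m would be a proper prefix of
    -- m'.
    have h5 : m = trunc m' m.degree := ext_psum fun t _ => by
      rw [psum_trunc]
      have h6 := psum_le_degree m t
      rcases le_or_gt t i.val with ht | ht
      · have := h0 t ht
        omega
      · have h7 := psum_mono m (show i.val + 1 ≤ t by omega)
        have h8 := psum_mono m' (show i.val + 1 ≤ t by omega)
        omega
    have h6 := eq_of_mem_minGens_of_le hm' hm.1 (h5 ▸ trunc_le _ _)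
    exact h.ne (congrArg toLex h6)
  -- In this position m has its first letter beyond x_i, while m', having more copies of x_i, still
  -- has x_i.
  refine ⟨(i, ⟨psum m (i + 1), h4.trans_le (hd m hm)⟩), ⟨rfl, h4⟩, ?_, ?_⟩
  · rw [bpolMon_apply, if_pos]
    · exact one_ne_zero
    · dsimp only
      omega
  · rw [bpolMon_apply, if_neg]
    dsimp only
    omega

end Admissible

/-! ### The composite of two differentials is zero. -/

section Complex

variable {k : Type*} [Field k] {n d : ℕ} {I : Ideal (MvPolynomial (Fin n) k)}

theorem basisElt_of_not_admissible {q : ℕ} {F : Finset (Fin n × Fin d)} {m : Fin n →₀ ℕ}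
    (h : ¬ Admissible I F m) : basisElt d I q F m = 0 :=
  dif_neg fun hc => h hc.1

theorem basisElt_eq_single {q : ℕ} {F : Finset (Fin n × Fin d)} {m : Fin n →₀ ℕ}
    (h : Admissible I F m ∧ F.card = q) :
    basisElt d I q F m = Finsupp.single ⟨(F, m), h⟩ 1 :=
  dif_pos h

/-- The set B disappears, since `basisElt` is 0 on pairs that are not admissible. -/
theorem diffElt_eq (q : ℕ) (F : Finset (Fin n × Fin d)) (m : Fin n →₀ ℕ) :
    diffElt d I q F m = ∑ p ∈ F, ((-1) ^ pos F p : MvPolynomial (Fin n × Fin d) k) •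
      ((X p : MvPolynomial (Fin n × Fin d) k) • basisElt d I q (F.erase p) m -
        monomial (shift I m p) (1 : k) • basisElt d I q (F.erase p) (angle I m p.1)) := by
  classical
  simp_rw [smul_sub, Finset.sum_sub_distrib, ← mul_smul]
  rw [diffElt]
  congr 1
  rw [bSet, Finset.sum_filter]
  refine Finset.sum_congr rfl fun p _ => ?_
  split_ifs with h
  · rfl
  · rw [basisElt_of_not_admissible h, smul_zero]

variable (d I) in
/-- The differential `P̃_{q+2} → P̃_{q+1}`. -/
noncomputable def diffMap (q : ℕ) :
    (AdmPair d I (q + 1) →₀ MvPolynomial (Fin n × Fin d) k) →ₗ[MvPolynomial (Fin n × Fin d) k]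
      (AdmPair d I q →₀ MvPolynomial (Fin n × Fin d) k) :=
  Finsupp.linearCombination _ fun s => diffElt d I q s.1.1 s.1.2

variable (d I) in
/-- The map `P̃_1 → S̃`. -/
noncomputable def diffGens :
    (AdmPair d I 0 →₀ MvPolynomial (Fin n × Fin d) k) →ₗ[MvPolynomial (Fin n × Fin d) k]
      MvPolynomial (Fin n × Fin d) k :=
  Finsupp.linearCombination _ fun s => monomial (bpolMon d s.1.2) 1

variable (d I) in
theorem diffMap_apply (q : ℕ) (z : AdmPair d I (q + 1) →₀ MvPolynomial (Fin n × Fin d) k) :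
    diffMap d I q z = ∑ s ∈ z.support, z s • diffElt d I q s.1.1 s.1.2 :=
  Finsupp.linearCombination_apply _ _

theorem diffMap_basisElt {q : ℕ} {F : Finset (Fin n × Fin d)} {m : Fin n →₀ ℕ}
    (h : Admissible I F m) (hF : F.card = q + 1) :
    diffMap d I q (basisElt d I (q + 1) F m) = diffElt d I q F m := by
  rw [basisElt_eq_single ⟨h, hF⟩, diffMap, Finsupp.linearCombination_single, one_smul]

theorem sum_sum_erase_eq_zero {α M : Type*} [DecidableEq α] [AddCommGroup M] (F : Finset α)
    (f : α → α → M) (h : ∀ a ∈ F, ∀ b ∈ F, a ≠ b → f a b + f b a = 0) :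
    ∑ a ∈ F, ∑ b ∈ F.erase a, f a b = 0 := by
  rw [Finset.sum_sigma']
  refine Finset.sum_involution (fun x _ => ⟨x.2, x.1⟩) ?_ ?_ ?_ ?_
  · rintro ⟨a, b⟩ hab
    simp only [Finset.mem_sigma, Finset.mem_erase] at hab
    exact h a hab.1 b hab.2.2 (Ne.symm hab.2.1)
  · rintro ⟨a, b⟩ hab _ heq
    simp only [Finset.mem_sigma, Finset.mem_erase] at hab
    simp only [Sigma.mk.injEq, heq_eq_eq] at heq
    exact hab.2.1 heq.1
  · rintro ⟨a, b⟩ hab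
    simp only [Finset.mem_sigma, Finset.mem_erase] at hab ⊢
    exact ⟨hab.2.2, Ne.symm hab.2.1, hab.1⟩
  · rintro ⟨a, b⟩ _
    rfl

theorem pos_erase_of_lt {F : Finset (Fin n × Fin d)} {p p' : Fin n × Fin d} (h : p.1 < p'.1) :
    pos (F.erase p') p = pos F p := by
  unfold pos
  rw [Finset.filter_erase, Finset.erase_eq_of_notMem]
  simp only [Finset.mem_filter, not_and, not_le]
  exact fun _ => h

theorem pos_erase_add_one {F : Finset (Fin n × Fin d)} {p p' : Fin n × Fin d} (hp : p ∈ F)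
    (h : p.1 < p'.1) : pos (F.erase p) p' + 1 = pos F p' := by
  unfold pos
  rw [Finset.filter_erase, Finset.card_erase_add_one]
  exact Finset.mem_filter.2 ⟨hp, h.le⟩

/-- Removing the element of smaller index lowers the position of the other by one; removing the
larger one leaves the smaller in place. -/
theorem sign_swap {R : Type*} [CommRing R] {F : Finset (Fin n × Fin d)} {p p' : Fin n × Fin d}
    (hp : p ∈ F) (h : p.1 < p'.1) :
    ((-1) ^ pos F p * (-1) ^ pos (F.erase p) p' : R) =
      -((-1) ^ pos F p' * (-1) ^ pos (F.erase p') p) := by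
  rw [pos_erase_of_lt h, ← pos_erase_add_one hp h, pow_succ]
  ring

open Classical in
/-- The contribution to `∂²(e(F, b-pol(m)))` of removing first `p` and then `p'`, up to sign. -/
noncomputable def cross (I : Ideal (MvPolynomial (Fin n) k)) (q : ℕ) (F : Finset (Fin n × Fin d))
    (m : Fin n →₀ ℕ) (p p' : Fin n × Fin d) :
    AdmPair d I q →₀ MvPolynomial (Fin n × Fin d) k :=
  (X p : MvPolynomial (Fin n × Fin d) k) •
      ((X p' : MvPolynomial (Fin n × Fin d) k) • basisElt d I q ((F.erase p).erase p') m -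
        monomial (shift I m p') (1 : k) •
          basisElt d I q ((F.erase p).erase p') (angle I m p'.1)) -
    -- The guard matters: a pair that is not admissible has basis element 0, but `diffElt` of it
    -- need not vanish.
    if Admissible I (F.erase p) (angle I m p.1) then
      monomial (shift I m p) (1 : k) •
        ((X p' : MvPolynomial (Fin n × Fin d) k) •
            basisElt d I q ((F.erase p).erase p') (angle I m p.1) -
          monomial (shift I (angle I m p.1) p') (1 : k) •
            basisElt d I q ((F.erase p).erase p') (angle I (angle I m p.1) p'.1))
    else 0

/-- With p' removed first the guard is harmless, because p stays movable in b. With p removed first,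
either p' stays movable in a and the two ⟨·⟩ commute, or the guarded part vanishes and a equals b',
so two terms of the other order cancel. Coefficients agree because all are quotients of x_p x_{p'}
b-pol(m). -/
theorem cross_comm (hI : IsBorelFixed I) (q : ℕ) {F : Finset (Fin n × Fin d)}
    {m : Fin n →₀ ℕ} (hF : Admissible I F m) {p p' : Fin n × Fin d} (hp : p ∈ F) (hp' : p' ∈ F)
    (hlt : p.1 < p'.1) : cross I q F m p p' = cross I q F m p' p := by
  classical
  obtain ⟨hm, hF⟩ := admissible_iff.1 hF
  have ha := (hF p hp).isAngle hI hm
  have hb := (hF p' hp').isAngle hI hm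
  have hpb : IsMoveAt (angle I m p'.1) p := (hF p hp).angle_of_lt hb hlt
  have hb' := hpb.isAngle hI hb.mem
  unfold cross
  rw [Finset.erase_right_comm (a := p') (b := p)]
  set F' := (F.erase p).erase p' with hF'
  have hF'F : ∀ r ∈ F', r ∈ F := fun r hr => Finset.mem_of_mem_erase (Finset.mem_of_mem_erase hr)
  have hFp : ∀ r ∈ F.erase p, r = p' ∨ r ∈ F' := fun r hr => by
    rw [hF', Finset.mem_erase]
    tauto
  have hFp' : ∀ r ∈ F.erase p', r = p ∨ r ∈ F' := fun r hr => by
    rw [hF', Finset.mem_erase, Finset.mem_erase]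
    rw [Finset.mem_erase] at hr
    tauto
  set a := angle I m p.1
  set b := angle I m p'.1
  set b' := angle I b p.1
  have hB : Admissible I F' b → Admissible I (F.erase p') b := fun h => by
    rw [admissible_iff] at h ⊢
    refine ⟨h.1, fun r hr => ?_⟩
    rcases hFp' r hr with rfl | hr
    · exact hpb
    · exact h.2 r hr
  have hB' : Admissible I F' b' → Admissible I (F.erase p') b := fun h => hB <| by
    rw [admissible_iff] at h ⊢
    exact ⟨hb.mem, fun r hr => (hF r (hF'F r hr)).angle_of_angle hb hb' (h.2 r hr)⟩
  have e1 : (if Admissible I (F.erase p') b then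
      monomial (shift I m p') (1 : k) •
        ((X p : MvPolynomial (Fin n × Fin d) k) • basisElt d I q F' b -
          monomial (shift I b p) (1 : k) • basisElt d I q F' b') else 0) =
      (X p * monomial (shift I m p') (1 : k)) • basisElt d I q F' b -
        monomial (shift I m p' + shift I b p) (1 : k) • basisElt d I q F' b' := by
    have e : monomial (shift I m p') (1 : k) •
        ((X p : MvPolynomial (Fin n × Fin d) k) • basisElt d I q F' b -
          monomial (shift I b p) (1 : k) • basisElt d I q F' b') =
      (X p * monomial (shift I m p') (1 : k)) • basisElt d I q F' b -
        monomial (shift I m p' + shift I b p) (1 : k) • basisElt d I q F' b' := by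
      rw [smul_sub, smul_smul, smul_smul, monomial_mul, one_mul, mul_comm (X p)]
    split_ifs with h
    · exact e
    · rw [basisElt_of_not_admissible fun hc => h (hB hc),
        basisElt_of_not_admissible fun hc => h (hB' hc)]
      simp
  have e2 : (if Admissible I (F.erase p) a then
      monomial (shift I m p) (1 : k) •
        ((X p' : MvPolynomial (Fin n × Fin d) k) • basisElt d I q F' a -
          monomial (shift I a p') (1 : k) • basisElt d I q F' (angle I a p'.1)) else 0) =
      (X p' * monomial (shift I m p) (1 : k)) • basisElt d I q F' a -
        monomial (shift I m p' + shift I b p) (1 : k) • basisElt d I q F' b' := by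
    have s1 := shift_add hI hm (hF p hp)
    have s2 := shift_add hI hm (hF p' hp')
    have s3 := shift_add hI hb.mem hpb
    by_cases hpa : IsMoveAt a p'
    · have ha' := hpa.isAngle hI ha.mem
      have hab : angle I a p'.1 = b' :=
        angle_comm hlt ha ha' hb hb' (by rw [hpa.1, (hF p' hp').1])
      have s4 := shift_add hI ha.mem hpa
      rw [hab] at s4 ha' ⊢
      have hA : Admissible I F' a → Admissible I (F.erase p) a := fun h => by
        rw [admissible_iff] at h ⊢
        refine ⟨h.1, fun r hr => ?_⟩
        rcases hFp r hr with rfl | hr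
        · exact hpa
        · exact h.2 r hr
      have hA' : Admissible I F' b' → Admissible I (F.erase p) a := fun h => hA <| by
        rw [admissible_iff] at h ⊢
        exact ⟨ha.mem, fun r hr => (hF r (hF'F r hr)).angle_of_angle ha ha' (h.2 r hr)⟩
      have hs : shift I m p + shift I a p' = shift I m p' + shift I b p := by
        refine add_right_cancel (b := bpolMon d b') ?_
        rw [add_assoc, s4, add_assoc, s3, add_left_comm, s1, add_left_comm (shift I m p'), s2]
        exact add_left_comm _ _ _
      have e : monomial (shift I m p) (1 : k) •
          ((X p' : MvPolynomial (Fin n × Fin d) k) • basisElt d I q F' a -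
            monomial (shift I a p') (1 : k) • basisElt d I q F' b') =
        (X p' * monomial (shift I m p) (1 : k)) • basisElt d I q F' a -
          monomial (shift I m p' + shift I b p) (1 : k) • basisElt d I q F' b' := by
        rw [smul_sub, smul_smul, smul_smul, monomial_mul, one_mul, mul_comm (X p'), hs]
      split_ifs with h
      · exact e
      · rw [basisElt_of_not_admissible fun hc => h (hA hc),
          basisElt_of_not_admissible fun hc => h (hA' hc)]
        simp
    · have hab : a = b' := angle_absorb hlt ha hb hb' fun hc =>
        hpa ⟨hc.1.trans (hF p' hp').1, (hF p' hp').1 ▸ hc.2⟩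
      have hpp : p' ∈ F.erase p := Finset.mem_erase.2 ⟨fun h => hlt.ne (by rw [h]), hp'⟩
      rw [if_neg fun hc => hpa ((admissible_iff.1 hc).2 p' hpp), ← hab]
      have hs : Finsupp.single p' 1 + shift I m p = shift I m p' + shift I b p := by
        refine add_right_cancel (b := bpolMon d b') ?_
        rw [add_assoc, add_assoc, s3, ← hab, s1, add_left_comm (shift I m p'), s2]
        exact add_left_comm _ _ _
      rw [← hs, X, monomial_mul, one_mul, sub_self]
  rw [e1, e2, smul_sub, smul_sub, smul_smul, smul_smul, smul_smul, smul_smul, mul_comm (X p') (X p)]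
  abel

theorem diffMap_diffElt (hI : IsBorelFixed I) (q : ℕ) {F : Finset (Fin n × Fin d)}
    {m : Fin n →₀ ℕ} (hF : Admissible I F m) (hcard : F.card = q + 2) :
    diffMap d I q (diffElt d I (q + 1) F m) = 0 := by
  classical
  have hcard' : ∀ p ∈ F, (F.erase p).card = q + 1 := fun p hp => by
    rw [Finset.card_erase_of_mem hp, hcard]
    rfl
  have h1 : diffMap d I q (diffElt d I (q + 1) F m) = ∑ p ∈ F, ∑ p' ∈ F.erase p,
      ((-1) ^ pos F p * (-1) ^ pos (F.erase p) p' : MvPolynomial (Fin n × Fin d) k) •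
        cross I q F m p p' := by
    rw [diffElt_eq, map_sum]
    refine Finset.sum_congr rfl fun p hp => ?_
    rw [map_smul, map_sub, map_smul, map_smul, diffMap_basisElt (hF.erase p) (hcard' p hp)]
    simp_rw [mul_smul, ← Finset.smul_sum]
    congr 1
    by_cases h : Admissible I (F.erase p) (angle I m p.1)
    · rw [diffMap_basisElt h (hcard' p hp), diffElt_eq, diffElt_eq, Finset.smul_sum,
        Finset.smul_sum, ← Finset.sum_sub_distrib]
      refine Finset.sum_congr rfl fun p' _ => ?_
      rw [cross, if_pos h, smul_comm, smul_comm (monomial (shift I m p) (1 : k)), ← smul_sub]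
    · rw [basisElt_of_not_admissible h, map_zero, smul_zero, sub_zero, diffElt_eq,
        Finset.smul_sum]
      refine Finset.sum_congr rfl fun p' _ => ?_
      rw [cross, if_neg h, sub_zero, smul_comm]
  rw [h1]
  have key : ∀ p ∈ F, ∀ p' ∈ F, p.1 < p'.1 →
      ((-1) ^ pos F p * (-1) ^ pos (F.erase p) p' : MvPolynomial (Fin n × Fin d) k) •
        cross I q F m p p' +
      ((-1) ^ pos F p' * (-1) ^ pos (F.erase p') p : MvPolynomial (Fin n × Fin d) k) •
        cross I q F m p' p = 0 := fun p hp p' hp' hlt => by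
    rw [sign_swap hp hlt, cross_comm hI q hF hp hp' hlt, neg_smul, neg_add_cancel]
  refine sum_sum_erase_eq_zero F _ fun p hp p' hp' hne => ?_
  rcases lt_trichotomy p.1 p'.1 with h | h | h
  · exact key p hp p' hp' h
  · have hF' := (admissible_iff.1 hF).2
    exact absurd ((hF' p hp).eq_of_fst_eq (hF' p' hp') h) hne
  · rw [add_comm]
    exact key p' hp' p hp h

theorem diffMap_diffMap (hI : IsBorelFixed I) (q : ℕ)
    (z : AdmPair d I (q + 2) →₀ MvPolynomial (Fin n × Fin d) k) :
    diffMap d I q (diffMap d I (q + 1) z) = 0 := by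
  rw [diffMap_apply d I (q + 1), map_sum]
  refine Finset.sum_eq_zero fun s _ => ?_
  rw [map_smul, diffMap_diffElt hI q s.2.1 s.2.2, smul_zero]

theorem diffGens_basisElt {m : Fin n →₀ ℕ} (hm : m ∈ minGens I) :
    diffGens d I (basisElt d I 0 ∅ m) = monomial (bpolMon d m) 1 := by
  rw [basisElt_eq_single ⟨⟨hm, by simp⟩, Finset.card_empty⟩, diffGens, Finsupp.linearCombination_single,
    one_smul]

theorem diffGens_diffMap (hI : IsBorelFixed I)
    (z : AdmPair d I 1 →₀ MvPolynomial (Fin n × Fin d) k) :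
    diffGens d I (diffMap d I 0 z) = 0 := by
  rw [diffMap_apply, map_sum]
  refine Finset.sum_eq_zero fun s _ => ?_
  obtain ⟨⟨F, m⟩, hF, hcard⟩ := s
  obtain ⟨p, rfl⟩ := Finset.card_eq_one.1 hcard
  obtain ⟨hm, hp⟩ := admissible_iff.1 hF
  replace hp := hp p (Finset.mem_singleton_self p)
  have ha := hp.isAngle hI hm
  simp only at hm ha hp ⊢
  rw [map_smul, diffElt_eq, Finset.sum_singleton, map_smul, map_sub, map_smul, map_smul,
    Finset.erase_singleton, diffGens_basisElt hm, diffGens_basisElt ha.mem,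
    smul_eq_mul (X p), smul_eq_mul (monomial (shift I m p) 1), monomial_mul,
    shift_add hI hm hp, X, monomial_mul, sub_self, smul_zero, smul_zero]

end Complex

/-! ### Normal forms modulo boundaries, and exactness. -/

section Exactness

variable {k : Type*} [Field k] {n d : ℕ} {I : Ideal (MvPolynomial (Fin n) k)}

open Classical in
/-- A chosen element of a nonempty finite set. -/
noncomputable def pick {α : Type*} (T : Finset α) : Option α :=
  if h : T.Nonempty then some h.choose else none

theorem mem_of_pick_eq_some {α : Type*} {T : Finset α} {a : α} (h : pick T = some a) : a ∈ T := by
  unfold pick at h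
  split_ifs at h with hT
  rw [← Option.some.inj h]
  exact hT.choose_spec

theorem exists_pick_eq_some {α : Type*} {T : Finset α} (h : T.Nonempty) :
    ∃ a, pick T = some a :=
  ⟨h.choose, dif_pos h⟩

open Classical in
/-- The variables dividing `x^u ∏_{p ∈ F} x_p` that can be moved in `m`. -/
noncomputable def movable (u : Fin n × Fin d →₀ ℕ) (F : Finset (Fin n × Fin d))
    (m : Fin n →₀ ℕ) : Finset (Fin n × Fin d) :=
  Finset.univ.filter fun p => IsMoveAt m p ∧ (u p ≠ 0 ∨ p ∈ F)

theorem mem_movable {u : Fin n × Fin d →₀ ℕ} {F : Finset (Fin n × Fin d)} {m : Fin n →₀ ℕ}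
    {p : Fin n × Fin d} : p ∈ movable u F m ↔ IsMoveAt m p ∧ (u p ≠ 0 ∨ p ∈ F) := by
  simp [movable]

/-- The normal forms `x^u e(F, b-pol(m))` modulo boundaries: those where the chosen movable
variable, if there is one, lies in `F`. -/
def IsNormal (u : Fin n × Fin d →₀ ℕ) (F : Finset (Fin n × Fin d)) (m : Fin n →₀ ℕ) : Prop :=
  ∀ p, pick (movable u F m) = some p → p ∈ F

theorem basisElt_apply {q : ℕ} (F : Finset (Fin n × Fin d)) (m : Fin n →₀ ℕ)
    (s : AdmPair d I q) : basisElt d I q F m s = if s.1 = (F, m) then 1 else 0 := by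
  classical
  unfold basisElt
  split_ifs with h1 h2 h2
  · have : (⟨(F, m), h1⟩ : AdmPair d I q) = s := Subtype.ext h2.symm
    rw [this, Finsupp.single_eq_same]
  · rw [Finsupp.single_eq_of_ne]
    rintro rfl
    exact h2 rfl
  · refine absurd ?_ h1
    have := s.2
    rwa [h2] at this
  · rfl

variable (d I) in
/-- The linear combinations of normal forms. -/
def normalForms (q : ℕ) : AddSubgroup (AdmPair d I q →₀ MvPolynomial (Fin n × Fin d) k) where
  carrier := {z | ∀ s u, coeff u (z s) ≠ 0 → IsNormal u s.1.1 s.1.2}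
  zero_mem' := by simp
  add_mem' := by
    intro a b ha hb s u hab
    rw [Finsupp.add_apply, coeff_add] at hab
    by_cases h : coeff u (a s) = 0
    · rw [h, zero_add] at hab
      exact hb s u hab
    · exact ha s u h
  neg_mem' := by
    intro a ha s u h
    rw [Finsupp.neg_apply, coeff_neg, neg_ne_zero] at h
    exact ha s u h

theorem monomial_smul_basisElt_mem_normalForms {q : ℕ} {u : Fin n × Fin d →₀ ℕ}
    {F : Finset (Fin n × Fin d)} {m : Fin n →₀ ℕ} (h : IsNormal u F m) (c : k) :
    monomial u c • basisElt d I q F m ∈ normalForms d I q := by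
  classical
  intro s v hv
  rw [Finsupp.smul_apply, basisElt_apply] at hv
  split_ifs at hv with hs
  · rw [smul_eq_mul, mul_one, coeff_monomial] at hv
    split_ifs at hv with huv
    · rw [hs, ← huv]
      exact h
    · exact absurd rfl hv
  · simp at hv

theorem neg_one_pow_smul_mem_iff {R M : Type*} [Ring R] [AddCommGroup M] [Module R M]
    {H : AddSubgroup M} (r : ℕ) {x : M} : ((-1) ^ r : R) • x ∈ H ↔ x ∈ H := by
  rcases neg_one_pow_eq_or R r with h | h <;> simp [h]

/-- Modulo boundaries and terms with lexicographically larger generators, every term is a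
combination of normal forms. -/
theorem monomial_smul_basisElt_mem (hI : IsBorelFixed I) (q : ℕ) {m : Fin n →₀ ℕ}
    (hm : m ∈ minGens I) (F : Finset (Fin n × Fin d)) (u : Fin n × Fin d →₀ ℕ) (c : k) :
    monomial u c • basisElt d I q F m ∈
      normalForms d I q ⊔ (LinearMap.range (diffMap d I q)).toAddSubgroup := by
  classical
  -- Only a subgroup: multiplying by a variable can destroy normality.
  set H := normalForms d I q ⊔ (LinearMap.range (diffMap d I q)).toAddSubgroup with hH
  have hst : IsStrictOrder (Fin n →₀ ℕ) fun a b => toLex b < toLex a :=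
    { irrefl := fun a => lt_irrefl _, trans := fun a b c h h' => lt_trans h' h }
  have hwf : (minGens I).WellFoundedOn fun a b => toLex b < toLex a :=
    (finite_minGens I).wellFoundedOn
  refine hwf.induction (P := fun m => ∀ F u c, monomial u c • basisElt d I q F m ∈ H) hm
    (fun m hm ih F u c => ?_) F u c
  by_cases hF : Admissible I F m ∧ F.card = q
  swap
  · rw [basisElt, dif_neg hF, smul_zero]
    exact H.zero_mem
  by_cases hN : IsNormal u F m
  · exact AddSubgroup.mem_sup_left (monomial_smul_basisElt_mem_normalForms hN c)
  obtain ⟨p, hpick, hpF⟩ : ∃ p, pick (movable u F m) = some p ∧ p ∉ F := by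
    unfold IsNormal at hN
    push Not at hN
    exact hN
  obtain ⟨hpm, hup⟩ := mem_movable.1 (mem_of_pick_eq_some hpick)
  replace hup : u p ≠ 0 := hup.resolve_right hpF
  -- The chosen p is outside F, hence divides x^u. The boundary of x^{u'} e(F ∪ {p}, m) contains x^u
  -- e(F, m) up to sign; its other terms are normal or have lexicographically larger generators.
  set u' := u - Finsupp.single p 1 with hu'
  have huu : u' + Finsupp.single p 1 = u := tsub_add_cancel_of_le (by
    rw [Finsupp.single_le_iff]
    omega)
  have hF' := (admissible_iff.1 hF.1).2
  have hadm : Admissible I (insert p F) m := admissible_iff.2 ⟨hm, fun r hr => by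
    rcases Finset.mem_insert.1 hr with rfl | hr
    · exact hpm
    · exact hF' r hr⟩
  have hmove : ∀ f ∈ insert p F, IsMoveAt m f := (admissible_iff.1 hadm).2
  have hsum : ∑ f ∈ insert p F, ((-1) ^ pos (insert p F) f : MvPolynomial (Fin n × Fin d) k) •
      (monomial (u' + Finsupp.single f 1) c • basisElt d I q ((insert p F).erase f) m -
        monomial (u' + shift I m f) c •
          basisElt d I q ((insert p F).erase f) (angle I m f.1)) ∈ H := by
    refine AddSubgroup.mem_sup_right
      ⟨monomial u' c • basisElt d I (q + 1) (insert p F) m, ?_⟩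
    rw [map_smul, diffMap_basisElt hadm (by rw [Finset.card_insert_of_notMem hpF, hF.2]),
      diffElt_eq, Finset.smul_sum]
    refine Finset.sum_congr rfl fun f _ => ?_
    rw [smul_comm, smul_sub, smul_smul, smul_smul, X, monomial_mul, monomial_mul, mul_one]
  have hsecond : ∀ f ∈ insert p F, monomial (u' + shift I m f) c •
      basisElt d I q ((insert p F).erase f) (angle I m f.1) ∈ H := fun f hf =>
    have ha := (hmove f hf).isAngle hI hm
    ih _ ha.mem ha.toLex_lt _ _ _
  have hfirst : ∀ f ∈ F, monomial (u' + Finsupp.single f 1) c •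
      basisElt d I q ((insert p F).erase f) m ∈ H := fun f hf => by
    have hfp : p ≠ f := fun h => hpF (h ▸ hf)
    refine AddSubgroup.mem_sup_left (monomial_smul_basisElt_mem_normalForms (fun r hr => ?_) c)
    -- Trading x_p for x_f between the monomial and the set keeps the total product, so the same p
    -- is chosen, and p now lies in the set.
    have hmov : movable (u' + Finsupp.single f 1) ((insert p F).erase f) m = movable u F m := by
      ext r
      rw [mem_movable, mem_movable]
      refine and_congr_right fun _ => ?_
      have h1 : u r = u' r + if p = r then 1 else 0 := by
        rw [← Finsupp.single_apply, ← Finsupp.add_apply, huu]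
      rw [Finsupp.add_apply, Finsupp.single_apply, Finset.mem_erase, Finset.mem_insert]
      by_cases hrf : f = r
      · subst hrf
        simp [hf]
      · by_cases hrp : p = r
        · subst hrp
          simp [hup, Ne.symm hrf]
        · rw [if_neg hrp] at h1
          rw [if_neg hrf, h1]
          simp [Ne.symm hrf, Ne.symm hrp]
    rw [hmov, hpick] at hr
    rw [← Option.some.inj hr]
    exact Finset.mem_erase.2 ⟨hfp, Finset.mem_insert_self _ _⟩
  rw [Finset.sum_insert hpF] at hsum
  have hrest := H.sum_mem fun f hf => (neg_one_pow_smul_mem_iff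
    (R := MvPolynomial (Fin n × Fin d) k) (pos (insert p F) f)).2
    (H.sub_mem (hfirst f hf) (hsecond f (Finset.mem_insert_of_mem hf)))
  have h1 := neg_one_pow_smul_mem_iff _ |>.1 ((H.add_mem_cancel_right hrest).1 hsum)
  have h2 := H.add_mem h1 (hsecond p (Finset.mem_insert_self _ _))
  rwa [sub_add_cancel, huu, Finset.erase_insert hpF] at h2

theorem exists_normalForms_add_diffMap (hI : IsBorelFixed I) (q : ℕ)
    (z : AdmPair d I q →₀ MvPolynomial (Fin n × Fin d) k) :
    ∃ w ∈ normalForms d I q, ∃ y, w + diffMap d I q y = z := by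
  have h : z ∈ normalForms d I q ⊔ (LinearMap.range (diffMap d I q)).toAddSubgroup := by
    induction z using Finsupp.induction_linear with
    | zero => exact zero_mem _
    | add a b ha hb => exact add_mem ha hb
    | single s f =>
      have : Finsupp.single s f =
          ∑ u ∈ f.support, monomial u (coeff u f) • basisElt d I q s.1.1 s.1.2 := by
        rw [← Finset.sum_smul, support_sum_monomial_coeff, basisElt_eq_single s.2,
          Finsupp.smul_single, smul_eq_mul, mul_one]
      rw [this]
      exact sum_mem fun u _ => monomial_smul_basisElt_mem hI q s.2.1.1 _ _ _
  obtain ⟨w, hw, _, ⟨y, rfl⟩, hz⟩ := AddSubgroup.mem_sup.1 h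
  exact ⟨w, hw, y, hz⟩

theorem coeff_neg_one_pow_mul {σ : Type*} (r : ℕ) (u : σ →₀ ℕ) (f : MvPolynomial σ k) :
    coeff u ((-1) ^ r * f) = (-1) ^ r * coeff u f := by
  rcases Nat.even_or_odd r with h | h <;> simp [h.neg_one_pow]

theorem diffElt_apply (q : ℕ) (F : Finset (Fin n × Fin d)) (m : Fin n →₀ ℕ)
    (s : AdmPair d I q) :
    diffElt d I q F m s = ∑ p ∈ F, (-1) ^ pos F p *
      (X p * (if s.1 = (F.erase p, m) then 1 else 0) -
        monomial (shift I m p) (1 : k) *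
          (if s.1 = (F.erase p, angle I m p.1) then 1 else 0)) := by
  rw [diffElt_eq, Finsupp.finsetSum_apply]
  refine Finset.sum_congr rfl fun p _ => ?_
  rw [Finsupp.smul_apply, Finsupp.sub_apply, Finsupp.smul_apply, Finsupp.smul_apply,
    basisElt_apply, basisElt_apply]
  rfl

theorem eq_zero_of_diffMap_eq_zero (hI : IsBorelFixed I) (q : ℕ)
    {z : AdmPair d I (q + 1) →₀ MvPolynomial (Fin n × Fin d) k}
    (hz : z ∈ normalForms d I (q + 1)) (h0 : diffMap d I q z = 0) : z = 0 := by
  classical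
  by_contra hne
  -- The generator m is taken lexicographically least in z. The coefficient of x^u x_p at e(F \ {p},
  -- m) in the image will isolate the coefficient of x^u in z at (F, m).
  obtain ⟨s₀, hs₀, hmin⟩ := z.support.exists_min_image (fun s => toLex s.1.2)
    (Finsupp.support_nonempty_iff.2 hne)
  obtain ⟨u, hu⟩ := MvPolynomial.ne_zero_iff.1 (Finsupp.mem_support_iff.1 hs₀)
  obtain ⟨⟨F, m⟩, hadm, hcard⟩ := s₀
  obtain ⟨hm, hF⟩ := admissible_iff.1 hadm
  dsimp only at hm hF hmin hcard
  obtain ⟨p, hpick⟩ : ∃ p, pick (movable u F m) = some p := by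
    obtain ⟨r, hr⟩ := Finset.card_pos.1 (show 0 < F.card by omega)
    exact exists_pick_eq_some ⟨r, mem_movable.2 ⟨hF r hr, Or.inr hr⟩⟩
  have hpF : p ∈ F := hz _ u hu p hpick
  have hcard' : (F.erase p).card = q := by
    rw [Finset.card_erase_of_mem hpF, hcard]
    rfl
  set s' : AdmPair d I q := ⟨(F.erase p, m), hadm.erase p, hcard'⟩ with hs'
  have hexp : coeff (u + Finsupp.single p 1) (diffMap d I q z s') =
      ∑ s ∈ z.support, ∑ f ∈ s.1.1, (-1) ^ pos s.1.1 f *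
        if (F.erase p, m) = (s.1.1.erase f, s.1.2) then
          coeff (u + Finsupp.single p 1) (z s * X f) else 0 := by
    rw [diffMap_apply, Finsupp.finsetSum_apply, coeff_sum]
    refine Finset.sum_congr rfl fun s hs => ?_
    obtain ⟨hms, hFs⟩ := admissible_iff.1 s.2.1
    rw [Finsupp.smul_apply, diffElt_apply, smul_eq_mul, Finset.mul_sum, coeff_sum]
    refine Finset.sum_congr rfl fun f hf => ?_
    -- Terms of the second sum have a generator strictly above one in z, so they cannot reach the
    -- least generator m.
    have hsec : s'.1 ≠ (s.1.1.erase f, angle I s.1.2 f.1) := fun h => by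
      have h1 : m = angle I s.1.2 f.1 := congrArg Prod.snd h
      have h2 := ((hFs f hf).isAngle hI hms).toLex_lt
      rw [← h1] at h2
      exact absurd (hmin s hs) (not_le.2 h2)
    rw [if_neg hsec, mul_zero, sub_zero, mul_left_comm, coeff_neg_one_pow_mul]
    split_ifs with h
    · rw [mul_one]
    · rw [mul_zero, mul_zero, coeff_zero]
  have hterm : ∀ s ∈ z.support, ∀ f ∈ s.1.1, (F.erase p, m) = (s.1.1.erase f, s.1.2) →
      coeff (u + Finsupp.single p 1) (z s * X f) ≠ 0 → f = p ∧ s.1 = (F, m) := by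
    rintro ⟨⟨F₁, m₁⟩, hs⟩ _ f hf heq hc
    dsimp only at hf heq
    obtain ⟨hFe, rfl⟩ := Prod.ext_iff.1 heq
    dsimp only at hFe hc
    rw [coeff_mul_X'] at hc
    split_ifs at hc with hfs
    · rw [Finsupp.mem_support_iff] at hfs
      have hN := hz _ _ hc
      dsimp only at hN
      set v := u + Finsupp.single p 1 - Finsupp.single f 1 with hv
      have hvv : v + Finsupp.single f 1 = u + Finsupp.single p 1 := tsub_add_cancel_of_le (by
        rw [Finsupp.single_le_iff]
        omega)
      -- A competing term has the same total product, hence the same chosen p, so normality puts p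
      -- in F₁; as p is missing from F \ {p} = F₁ \ {f}, it is the removed element.
      have hmov : movable v F₁ m = movable u F m := by
        ext r
        rw [mem_movable, mem_movable]
        refine and_congr_right fun _ => ?_
        have h1 := DFunLike.congr_fun hvv r
        rw [Finsupp.add_apply, Finsupp.add_apply, Finsupp.single_apply, Finsupp.single_apply] at h1
        have h2 : r ∈ F.erase p ↔ r ∈ F₁.erase f := by rw [hFe]
        rw [Finset.mem_erase, Finset.mem_erase] at h2
        by_cases hrf : f = r
        · subst hrf
          by_cases hrp : p = f
          · subst hrp
            simp [hf, hpF]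
          · rw [if_pos rfl, if_neg hrp] at h1
            have h3 : u f ≠ 0 := by omega
            simp [hf, h3]
        · by_cases hrp : p = r
          · subst hrp
            rw [if_pos rfl, if_neg hrf] at h1
            have h3 : v p ≠ 0 := by omega
            simp [hpF, h3]
          · rw [if_neg hrp, if_neg hrf, add_zero, add_zero] at h1
            have h4 : r ∈ F ↔ r ∈ F₁ := by simpa [Ne.symm hrf, Ne.symm hrp] using h2
            rw [h1, h4]
      have hpF₁ : p ∈ F₁ := hN p (by rw [hmov, hpick])
      have hfp : f = p := by
        by_contra hne
        have : p ∈ F.erase p := hFe ▸ Finset.mem_erase.2 ⟨Ne.symm hne, hpF₁⟩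
        exact absurd this (Finset.notMem_erase p F)
      refine ⟨hfp, ?_⟩
      subst hfp
      exact Prod.ext (by rw [← Finset.insert_erase hpF, hFe, Finset.insert_erase hf]) rfl
    · exact absurd rfl hc
  rw [h0, Finsupp.zero_apply, coeff_zero, Finset.sum_eq_single_of_mem _ hs₀,
    Finset.sum_eq_single_of_mem p hpF, if_pos rfl, coeff_mul_X] at hexp
  · exact hu ((mul_eq_zero.1 hexp.symm).resolve_left (pow_ne_zero _ (by simp)))
  · intro f hf hfp
    dsimp only at hf ⊢
    rw [mul_eq_zero]
    right
    split_ifs with h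
    · by_contra hc
      exact hfp (hterm _ hs₀ f hf h hc).1
    · rfl
  · intro s hs hss
    refine Finset.sum_eq_zero fun f hf => ?_
    rw [mul_eq_zero]
    right
    split_ifs with h
    · by_contra hc
      exact hss (Subtype.ext (hterm s hs f hf h hc).2)
    · rfl

/-- For F = ∅ a normal term x^u e(∅, m) has no movable variable of m dividing x^u. Such terms have
distinct images x^u b-pol(m): of two different generators, the larger one's polarization contains a
movable variable of the smaller one that the smaller term's image lacks. -/
theorem eq_zero_of_diffGens_eq_zero (hd : ∀ m ∈ minGens I, m.degree ≤ d)
    {z : AdmPair d I 0 →₀ MvPolynomial (Fin n × Fin d) k}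
    (hz : z ∈ normalForms d I 0) (h0 : diffGens d I z = 0) : z = 0 := by
  classical
  by_contra hne
  obtain ⟨s₀, hs₀⟩ := Finsupp.support_nonempty_iff.2 hne
  obtain ⟨u, hu⟩ := MvPolynomial.ne_zero_iff.1 (Finsupp.mem_support_iff.1 hs₀)
  have hfix : ∀ s : AdmPair d I 0, ∀ v, coeff v (z s) ≠ 0 → ∀ p, IsMoveAt s.1.2 p → v p = 0 := by
    intro s v hv p hp
    by_contra hvp
    obtain ⟨r, hr⟩ := exists_pick_eq_some ⟨p, mem_movable.2 ⟨hp, Or.inl hvp⟩⟩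
    have := hz s v hv r hr
    rw [Finset.card_eq_zero.1 s.2.2] at this
    exact absurd this (Finset.notMem_empty r)
  have hlt : ∀ s s' : AdmPair d I 0, ∀ v v', coeff v (z s) ≠ 0 →
      v' + bpolMon d s'.1.2 = v + bpolMon d s.1.2 → ¬ toLex s.1.2 < toLex s'.1.2 := by
    intro s s' v v' hv heq hlt
    obtain ⟨p, hp, hp1, hp2⟩ := exists_isMoveAt_of_toLex_lt hd s.2.1.1 s'.2.1.1 hlt
    have h1 := DFunLike.congr_fun heq p
    rw [Finsupp.add_apply, Finsupp.add_apply, hp2, hfix s v hv p hp] at h1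
    omega
  have hexp := congrArg (coeff (u + bpolMon d s₀.1.2)) h0
  rw [diffGens, Finsupp.linearCombination_apply, Finsupp.sum, coeff_sum, coeff_zero,
    Finset.sum_eq_single_of_mem _ hs₀, smul_eq_mul, coeff_mul_monomial, mul_one] at hexp
  · exact hu hexp
  · intro s _ hss
    rw [smul_eq_mul, coeff_mul_monomial', mul_one]
    split_ifs with hle
    · by_contra hc
      have heq := tsub_add_cancel_of_le hle
      have hm : s.1.2 = s₀.1.2 := toLex.injective (le_antisymm
        (not_lt.1 (hlt s₀ s _ _ hu heq)) (not_lt.1 (hlt s s₀ _ _ hc heq.symm)))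
      refine hss (Subtype.ext (Prod.ext ?_ hm))
      rw [Finset.card_eq_zero.1 s.2.2, Finset.card_eq_zero.1 s₀.2.2]
    · rfl

theorem exact_diffMap (hI : IsBorelFixed I) (q : ℕ) :
    Function.Exact (diffMap d I (q + 1)) (diffMap d I q) := by
  intro z
  constructor
  · intro hz
    obtain ⟨w, hw, y, rfl⟩ := exists_normalForms_add_diffMap hI (q + 1) z
    rw [map_add, diffMap_diffMap hI, add_zero] at hz
    exact ⟨y, by rw [eq_zero_of_diffMap_eq_zero hI q hw hz, zero_add]⟩
  · rintro ⟨y, rfl⟩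
    exact diffMap_diffMap hI q y

theorem exact_diffGens (hI : IsBorelFixed I) (hd : ∀ m ∈ minGens I, m.degree ≤ d) :
    Function.Exact (diffMap d I 0) (diffGens d I) := by
  intro z
  constructor
  · intro hz
    obtain ⟨w, hw, y, rfl⟩ := exists_normalForms_add_diffMap hI 0 z
    rw [map_add, diffGens_diffMap hI, add_zero] at hz
    refine ⟨y, ?_⟩
    rw [eq_zero_of_diffGens_eq_zero hd hw hz]
    exact (zero_add _).symm
  · rintro ⟨y, rfl⟩
    exact diffGens_diffMap hI y

end Exactness

/-! ### Fine grading, minimality and assembly of the resolution. -/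

section Grading

variable {k : Type*} [Field k]

theorem weight_fineWeight {σ : Type*} [DecidableEq σ] (u : σ →₀ ℕ) :
    Finsupp.weight (fineWeight σ) u = expVec u := by
  funext s
  rw [Finsupp.weight_apply, Finsupp.sum, Finset.sum_apply]
  simp only [fineWeight, Pi.smul_apply, Pi.single_apply, expVec, nsmul_eq_mul, mul_ite, mul_one,
    mul_zero]
  rw [Finset.sum_ite_eq]
  split_ifs with h
  · rfl
  · rw [Finsupp.notMem_support_iff.1 h]
    rfl

theorem expVec_add {σ : Type*} (u v : σ →₀ ℕ) : expVec (u + v) = expVec u + expVec v := by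
  funext s
  simp [expVec]

theorem isWeightedHomogeneous_monomial_expVec {σ : Type*} [DecidableEq σ] {u v w : σ →₀ ℕ}
    (h : u + w = v) (c : k) :
    IsWeightedHomogeneous (fineWeight σ) (monomial u c) (expVec v - expVec w) := by
  refine isWeightedHomogeneous_monomial _ _ _ ?_
  rw [weight_fineWeight, ← h, expVec_add, add_sub_cancel_right]

theorem isWeightedHomogeneous_neg_one_pow_mul {σ : Type*} [DecidableEq σ] {f : MvPolynomial σ k}
    {a : σ → ℤ} (hf : IsWeightedHomogeneous (fineWeight σ) f a) (r : ℕ) :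
    IsWeightedHomogeneous (fineWeight σ) ((-1) ^ r * f) a := by
  rcases Nat.even_or_odd r with h | h
  · simpa [h.neg_one_pow] using hf
  · simpa [h.neg_one_pow] using hf.neg

theorem monomial_mem_span_X {σ : Type*} {u : σ →₀ ℕ} (hu : u ≠ 0) :
    monomial u (1 : k) ∈ Ideal.span (Set.range (X : σ → MvPolynomial σ k)) := by
  obtain ⟨i, hi⟩ := Finsupp.ne_iff.1 hu
  exact Ideal.mem_of_dvd _ (X_dvd_monomial.2 (Or.inr hi)) (Ideal.subset_span ⟨i, rfl⟩)

variable {n d : ℕ} {I : Ideal (MvPolynomial (Fin n) k)}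

theorem diffElt_isWeightedHomogeneous (hI : IsBorelFixed I) (q : ℕ)
    {F : Finset (Fin n × Fin d)} {m : Fin n →₀ ℕ} (hF : Admissible I F m) (s : AdmPair d I q) :
    IsWeightedHomogeneous (fineWeight (Fin n × Fin d)) (diffElt d I q F m s)
      (expVec (bpolMon d m + ∑ p ∈ F, Finsupp.single p 1) -
        expVec (bpolMon d s.1.2 + ∑ p ∈ s.1.1, Finsupp.single p 1)) := by
  obtain ⟨hm, hF⟩ := admissible_iff.1 hF
  rw [diffElt_apply]
  refine IsWeightedHomogeneous.sum _ _ _ fun p hp => ?_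
  refine isWeightedHomogeneous_neg_one_pow_mul (IsWeightedHomogeneous.sub ?_ ?_) _
  · split_ifs with h
    · rw [mul_one, h]
      refine isWeightedHomogeneous_monomial_expVec ?_ _
      rw [add_left_comm, Finset.add_sum_erase _ (fun p => Finsupp.single p 1) hp]
    · rw [mul_zero]
      exact isWeightedHomogeneous_zero _ _ _
  · split_ifs with h
    · rw [mul_one, h]
      refine isWeightedHomogeneous_monomial_expVec ?_ _
      rw [← add_assoc, shift_add hI hm (hF p hp), add_comm (Finsupp.single p 1), add_assoc,
        Finset.add_sum_erase _ (fun p => Finsupp.single p 1) hp]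
    · rw [mul_zero]
      exact isWeightedHomogeneous_zero _ _ _

theorem diffMap_isFineHomogeneous (hI : IsBorelFixed I) (q : ℕ) (a : Fin n × Fin d → ℤ)
    {f : AdmPair d I (q + 1) →₀ MvPolynomial (Fin n × Fin d) k}
    (hf : IsFineHomogeneous (basisDeg d I (q + 2)) a f) :
    IsFineHomogeneous (basisDeg d I (q + 1)) a (diffMap d I q f) := by
  intro s
  rw [diffMap_apply, Finsupp.finsetSum_apply]
  refine IsWeightedHomogeneous.sum _ _ _ fun t _ => ?_
  rw [Finsupp.smul_apply, smul_eq_mul]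
  have h := (hf t).mul (diffElt_isWeightedHomogeneous hI q t.2.1 s)
  rwa [basisDeg, sub_add_sub_cancel] at h

theorem diffElt_mem (hI : IsBorelFixed I) (hd : ∀ m ∈ minGens I, m.degree ≤ d) (q : ℕ)
    {F : Finset (Fin n × Fin d)} {m : Fin n →₀ ℕ} (hF : Admissible I F m) :
    diffElt d I q F m ∈
      Ideal.span (Set.range (X : Fin n × Fin d → MvPolynomial (Fin n × Fin d) k)) •
        (⊤ : Submodule (MvPolynomial (Fin n × Fin d) k)
          (AdmPair d I q →₀ MvPolynomial (Fin n × Fin d) k)) := by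
  obtain ⟨hm, hF⟩ := admissible_iff.1 hF
  rw [diffElt_eq]
  refine Submodule.sum_mem _ fun p hp => Submodule.smul_mem _ _ (Submodule.sub_mem _ ?_ ?_)
  · exact Submodule.smul_mem_smul (Ideal.subset_span ⟨p, rfl⟩) trivial
  · exact Submodule.smul_mem_smul (monomial_mem_span_X (shift_ne_zero hI hd hm (hF p hp))) trivial

theorem diff_zero_apply (z : AdmPair d I 0 →₀ MvPolynomial (Fin n × Fin d) k) :
    diff d I 0 z = Finsupp.single () (diffGens d I z) := by
  rw [diffGens, Finsupp.linearCombination_apply, Finsupp.sum, Finsupp.single_finsetSum]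
  refine (Finsupp.linearCombination_apply _ _).trans (Finset.sum_congr rfl fun s _ => ?_)
  exact Finsupp.smul_single _ _ _

theorem aug_apply (f : Unit →₀ MvPolynomial (Fin n × Fin d) k) :
    aug d I f = Ideal.Quotient.mk (bpol d I) (f ()) := by
  have h : aug d I f = f () • Ideal.Quotient.mk (bpol d I) 1 :=
    Finsupp.linearCombination_unique _ _ _
  exact h.trans (congrArg (Ideal.Quotient.mk (bpol d I)) (mul_one (f ())))

theorem range_diffGens :
    LinearMap.range (diffGens d I) = bpol d I := by
  rw [diffGens, Finsupp.range_linearCombination, bpol, Ideal.span]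
  congr 1
  ext f
  constructor
  · rintro ⟨s, rfl⟩
    exact ⟨s.1.2, s.2.1.1, rfl⟩
  · rintro ⟨m, hm, rfl⟩
    exact ⟨⟨(∅, m), ⟨hm, by simp⟩, rfl⟩, rfl⟩

/-- Membership in a monomial ideal is tested on the support, which a homogeneous component can only
shrink. -/
theorem weightedHomogeneousComponent_mem_bpol {f : MvPolynomial (Fin n × Fin d) k}
    (hf : f ∈ bpol d I) (a : Fin n × Fin d → ℤ) :
    weightedHomogeneousComponent (fineWeight (Fin n × Fin d)) a f ∈ bpol d I := by
  classical
  have himg : bpol d I =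
      Ideal.span ((fun u => monomial u (1 : k)) '' (bpolMon d '' minGens I)) := by
    rw [bpol, Set.image_image]
  rw [himg, mem_ideal_span_monomial_image] at hf ⊢
  intro u hu
  refine hf u ?_
  rw [mem_support_iff, coeff_weightedHomogeneousComponent] at hu
  rw [mem_support_iff]
  exact fun h => hu (by rw [h, ite_self])

theorem finite_basisIdx (d : ℕ) (I : Ideal (MvPolynomial (Fin n) k)) :
    ∀ q, Finite (BasisIdx d I q)
  | 0 => inferInstanceAs (Finite Unit)
  | q + 1 => by
    have := (finite_minGens I).to_subtype
    refine Finite.of_injective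
      (β := Finset (Fin n × Fin d) × minGens I)
      (fun s : AdmPair d I q => (s.1.1, ⟨s.1.2, s.2.1.1⟩)) fun s t h => ?_
    simp only [Prod.mk.injEq, Subtype.mk.injEq] at h
    exact Subtype.ext (Prod.ext h.1 h.2)

/-- Properness of I enters here: it excludes the generator 1, whose image under ∂ would be a unit.
-/
theorem bpolMon_ne_zero (hproper : I ≠ ⊤) (hd : ∀ m ∈ minGens I, m.degree ≤ d)
    {m : Fin n →₀ ℕ} (hm : m ∈ minGens I) : bpolMon d m ≠ 0 := by
  intro h
  have h1 := degree_bpolMon (hd m hm)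
  rw [h, map_zero, eq_comm, Finsupp.degree_eq_zero_iff] at h1
  refine hproper ((Ideal.eq_top_iff_one I).2 ?_)
  have h2 := hm.1
  rwa [h1] at h2

theorem IsBorelFixed.isMinimalGradedFreeResolution (hI : IsBorelFixed I) (hproper : I ≠ ⊤)
    (hd : ∀ m ∈ minGens I, m.degree ≤ d) :
    IsMinimalGradedFreeResolution (basisDeg d I) (diff d I) (bpol d I) (aug d I) where
  finite := finite_basisIdx d I
  ideal_homogeneous f hf a := weightedHomogeneousComponent_mem_bpol hf a
  diff_homogeneous
    | 0, a, f, hf => by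
      intro b
      rw [diff_zero_apply, Finsupp.single_eq_same, diffGens, Finsupp.linearCombination_apply]
      refine IsWeightedHomogeneous.sum _ _ _ fun s _ => ?_
      have h1 := hf s
      have h2 := isWeightedHomogeneous_monomial_expVec (k := k) (add_zero (bpolMon d s.1.2)) 1
      have h3 := h1.mul h2
      have h4 : a - basisDeg d I 1 s + (expVec (bpolMon d s.1.2) - expVec 0) =
          a - basisDeg d I 0 b := by
        have : basisDeg d I 1 s = expVec (bpolMon d s.1.2) := by
          change expVec (bpolMon d s.1.2 + ∑ p ∈ s.1.1, Finsupp.single p 1) = _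
          rw [Finset.card_eq_zero.1 s.2.2, Finset.sum_empty, add_zero]
        rw [this, sub_add_sub_cancel]
        rfl
      rwa [h4] at h3
    | q + 1, a, f, hf => diffMap_isFineHomogeneous hI q a hf
  aug_homogeneous a f hf := by
    refine ⟨f (), ?_, aug_apply f⟩
    have h := hf ()
    rwa [basisDeg, sub_zero] at h
  aug_surjective x := by
    obtain ⟨f, rfl⟩ := Ideal.Quotient.mk_surjective x
    refine ⟨Finsupp.single () f, ?_⟩
    rw [aug_apply, Finsupp.single_eq_same]
  exact_zero := by
    intro f
    rw [aug_apply, Ideal.Quotient.eq_zero_iff_mem, ← range_diffGens, LinearMap.mem_range]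
    refine exists_congr fun z => ?_
    rw [diff_zero_apply]
    constructor
    · intro h
      rw [h]
      exact (Finsupp.unique_single f).symm
    · intro h
      rw [← h, Finsupp.single_eq_same]
  exact_succ
    | 0 => by
      intro z
      rw [diff_zero_apply, Finsupp.single_eq_zero]
      exact exact_diffGens hI hd z
    | q + 1 => exact_diffMap hI q
  minimal
    | 0 => by
      rintro _ ⟨z, rfl⟩
      refine (congrArg (· ∈ _) (Finsupp.linearCombination_apply _ _)).mpr ?_
      refine Submodule.sum_mem _ fun s _ => Submodule.smul_mem _ _ ?_
      have h := Submodule.smul_mem_smul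
        (monomial_mem_span_X (k := k) (bpolMon_ne_zero hproper hd s.2.1.1))
        (Submodule.mem_top (x := Finsupp.single () (1 : MvPolynomial (Fin n × Fin d) k)))
      rwa [Finsupp.smul_single, smul_eq_mul, mul_one] at h
    | q + 1 => by
      rintro _ ⟨z, rfl⟩
      change diffMap d I q z ∈ _
      rw [diffMap_apply]
      exact Submodule.sum_mem _ fun s _ => Submodule.smul_mem _ _ (diffElt_mem hI hd q s.2.1)

end Grading

end BorelFixed

theorem mainTheorem1 {k : Type*} [Field k] {n d : ℕ} (I : Ideal (MvPolynomial (Fin n) k))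
    (hI : BorelFixed.IsBorelFixed I) (hproper : I ≠ ⊤)
    (hd : ∀ m ∈ BorelFixed.minGens I, m.degree ≤ d) :
    IsMinimalGradedFreeResolution (BorelFixed.basisDeg d I) (BorelFixed.diff d I)
      (BorelFixed.bpol d I) (BorelFixed.aug d I) :=
  hI.isMinimalGradedFreeResolution hproper hd
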